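/- **Setting.** A *timed automaton* $A=(Q,q_0,X,\Sigma^\varepsilon,E,\mathrm{Inv})$ has finitely many locations $Q$ with initial location $q_0$, a finite set $X$ of clocks, a finite alphabet $\Sigma$ with $\varepsilon\notin\Sigma$ and $\Sigma^\varepsilon=\Sigma\cup\{\varepsilon\}$, a finite set $E$ of edges $(q,\gamma,a,R,q')$ with $a\in\Sigma^\varepsilon$, $R\subseteq X$ and a guard $\gamma$ that is a finite conjunction of constraints $x\bowtie c$ with $x\in X$, $c\in\mathbb N$, $\bowtie\in\{<,\le,=,\ge,>\}$, and invariants $\mathrm{Inv}(q)$ that are finite conjunctions of constraints $x<c$ or $x\le c$. Its states are pairs $(q,v)$ with $v\in\mathbb R_{\ge0}^X$; the initial state is $(q_0,\vec 0)$. There is an action step $(q,v)\xrightarrow{a}(q',v')$ iff there is an edge $(q,\gamma,a,R,q')$ such that $v$ satisfies $\gamma$, $v'=v[R\mapsto0]$ and $v'$ satisfies $\mathrm{Inv}(q')$; there is a delay step $(q,v)\xrightarrow{\delta}(q,v+\delta)$ for $\delta\in\mathbb R_{\ge0}$ iff $v+\delta'$ satisfies $\mathrm{Inv}(q)$ for all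 $0\le\delta'\le\delta$. A *run* is a finite sequence of steps from the initial state. Its *timed word* is $(\delta_0,a_0)\cdots(\delta_n,a_n)$, where $a_0,\dots,a_n\in\Sigma$ are its actions other than $\varepsilon$, in order, and $\delta_i$ is the total time elapsed between $a_{i-1}$ and $a_i$ (for $i=0$: since the start); what follows the last action is dropped. The timed language $\mathcal L$ of a system is the set of the timed words of its runs. Let $\Sigma=\Sigma_l\sqcup\Sigma_h$ (low-level and high-level actions) and $\Sigma_c\subseteq\Sigma$ (controllable actions), $\Sigma_u=\Sigma\setminus\Sigma_c$. For a system $S$ let $S\backslash\Sigma_h$ be $S$ without its steps labelled in $\Sigma_h$, and $S/\Sigma_h$ be $S$ with these steps relabelled by $\varepsilon$. $S$ is *SNNI* (strongly non-deterministically non-interferent) iff $\mathcal L(S\backslash\Sigma_h)=\mathcal L(S/\Sigma_h)$. A *controller* $C$ for $A$ assigns to each run $\rho$ of $A$ a set $C(\rho)\subseteq\Sigma_c\cup\{\lambda\}$, where $\lambda$ stands for letting time pass, such that: every $a\in C(\rho)\cap\Sigma_c$ can be taken in the last state of $\rho$; if $\lambda\in C(\rho)$, then a positive delay is possible in the last state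 of $\rho$; and $C(\rho)\ne\emptyset$ whenever a positive delay is possible in the last state of $\rho$ (so a controller may stop time only in favour of a controllable action). The controlled system $C(A)$ is given by its runs: the empty run is one, and a run $\rho$ of $C(A)$ may be extended by a step of $A$ labelled $e$ iff $e\in\Sigma_u\cup\{\varepsilon\}$, or $e\in\Sigma_c\cap C(\rho)$, or $e$ is a delay and for all $0\le\delta<e$ the delay $\delta$ is possible after $\rho$ and $\lambda\in C(\rho\xrightarrow{\delta})$. The *SNNI control problem* asks, given $(A,\Sigma_h,\Sigma_c)$, whether there is a controller $C$ such that $C(A)$ is SNNI. The *SNNI controller synthesis problem* asks, given $(A,\Sigma_h,\Sigma_c)$, to compute a finite description of such a controller if there is one, and to report that there is none otherwise. **Theorem.** For general timed automata, the SNNI control problem is undecidable, and the SNNI controller synthesis problem is not solvable by any algorithm, whatever scheme is used to describe controllers by finite data. -/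

import Mathlib

open scoped NNReal

namespace TimedSNNI

/-! ### Timed automata

Locations, clocks and actions are named by natural numbers. An automaton is a finite piece of
data, so only finitely many names occur in it; names that do not occur play no role. -/

/-- The comparison symbols of atomic clock constraints. -/
inductive Cmp where
  | lt | le | eq | ge | gt

def Cmp.holds : Cmp → ℝ≥0 → ℝ≥0 → Prop
  | .lt, x, c => x < c
  | .le, x, c => x ≤ c
  | .eq, x, c => x = c
  | .ge, x, c => x ≥ c
  | .gt, x, c => x > c

/-- An atomic constraint `clock ⋈ bound`. -/
structure Atom where
  clock : ℕ
  cmp : Cmp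
  bound : ℕ

/-- A conjunct `clock < bound` (if `strict`) or `clock ≤ bound` (otherwise) of the invariant of
the location `loc`. -/
structure InvAtom where
  loc : ℕ
  clock : ℕ
  strict : Bool
  bound : ℕ

/-- An edge. The guard is a conjunction of atomic constraints; the label `none` is `ε`; `reset`
lists the clocks that are set to `0`. -/
structure Edge where
  src : ℕ
  guard : List Atom
  label : Option ℕ
  reset : List ℕ
  tgt : ℕ

/-- A timed automaton. The invariant of a location `q` is the conjunction of the members of `inv`
whose `loc` is `q`. -/
structure TimedAutomaton where
  start : ℕ
  edges : List Edge
  inv : List InvAtom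

/-- A clock valuation. -/
abbrev Val := ℕ → ℝ≥0

def Atom.holds (g : Atom) (v : Val) : Prop := g.cmp.holds (v g.clock) g.bound

def InvAtom.holds (g : InvAtom) (v : Val) : Prop :=
  (if g.strict then Cmp.lt else Cmp.le).holds (v g.clock) g.bound

def TimedAutomaton.InvHolds (A : TimedAutomaton) (q : ℕ) (v : Val) : Prop :=
  ∀ g ∈ A.inv, g.loc = q → g.holds v

def Val.delay (v : Val) (d : ℝ≥0) : Val := fun x => v x + d

def Val.reset (v : Val) (R : List ℕ) : Val := fun x => if x ∈ R then 0 else v x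

/-! ### Timed transition systems, runs, traces and languages -/

/-- Labels of transitions: `act (some a)` is the action `a`, `act none` is `ε`, and `delay d` is
a time step. -/
inductive Label where
  | act (a : Option ℕ)
  | delay (d : ℝ≥0)

/-- A transition system with timed labels. -/
structure TTS where
  State : Type
  start : State
  trans : State → Label → State → Prop

/-- `S.Reaches ls s`: some run from the initial state has the sequence of labels `ls` (in
chronological order) and ends in `s`. -/
inductive TTS.Reaches (S : TTS) : List Label → S.State → Prop
  | nil : S.Reaches [] S.start
  | snoc {ls : List Label} {s s' : S.State} {l : Label} :
      S.Reaches ls s → S.trans s l s' → S.Reaches (ls ++ [l]) s'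

/-- The timed word of a sequence of labels, where `d` is the time already elapsed since the last
visible action. The delays before a visible action are added up, the time spent around `ε`-steps
counts towards the next visible action, and what follows the last visible action is dropped. -/
def traceFrom : ℝ≥0 → List Label → List (ℝ≥0 × ℕ)
  | _, [] => []
  | d, .delay d' :: ls => traceFrom (d + d') ls
  | d, .act none :: ls => traceFrom d ls
  | d, .act (some a) :: ls => (d, a) :: traceFrom 0 ls

/-- The timed language generated by `S`. -/
def TTS.language (S : TTS) : Set (List (ℝ≥0 × ℕ)) :=
  {w | ∃ ls s, S.Reaches ls s ∧ traceFrom 0 ls = w}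

/-- `S \ L`: transitions with an action in `L` are removed. -/
def TTS.restrict (S : TTS) (L : List ℕ) : TTS where
  State := S.State
  start := S.start
  trans s l s' := S.trans s l s' ∧ ∀ a ∈ L, l ≠ .act (some a)

/-- Turns the actions in `L` into `ε`. -/
def hideLabel (L : List ℕ) : Label → Label
  | .act (some a) => if a ∈ L then .act none else .act (some a)
  | l => l

/-- `S / L`: transitions with an action in `L` become `ε`-transitions. -/
def TTS.hide (S : TTS) (L : List ℕ) : TTS where
  State := S.State
  start := S.start
  trans s l s' := ∃ l', S.trans s l' s' ∧ hideLabel L l' = l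

/-- Strong non-deterministic non-interference with respect to the high-level actions. -/
def TTS.IsSNNI (S : TTS) (high : List ℕ) : Prop :=
  (S.restrict high).language = (S.hide high).language

/-- A state of a timed automaton: a location and a clock valuation. -/
abbrev AState := ℕ × Val

/-- The transition relation of the semantics of a timed automaton. -/
def TimedAutomaton.Step (A : TimedAutomaton) (s : AState) : Label → AState → Prop
  | .act a, s' => ∃ e ∈ A.edges, e.src = s.1 ∧ e.label = a ∧ e.tgt = s'.1 ∧
      (∀ g ∈ e.guard, g.holds s.2) ∧ s'.2 = s.2.reset e.reset ∧ A.InvHolds s'.1 s'.2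
  | .delay d, s' => s'.1 = s.1 ∧ s'.2 = s.2.delay d ∧
      ∀ d', 0 ≤ d' → d' ≤ d → A.InvHolds s.1 (s.2.delay d')

/-- The semantics of a timed automaton. -/
def TimedAutomaton.semantics (A : TimedAutomaton) : TTS where
  State := AState
  start := (A.start, fun _ => 0)
  trans := A.Step

/-! ### Controllers -/

/-- A finite sequence of steps from the initial state, **most recent step first**: each entry is
the label of a step and the state that the step leads to. -/
abbrev Hist := List (Label × AState)

/-- The last state of a history. -/
def TimedAutomaton.last (A : TimedAutomaton) : Hist → AState
  | [] => A.semantics.start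
  | (_, s) :: _ => s

/-- `A.IsRun ρ`: the history `ρ` is a run of `A`. -/
def TimedAutomaton.IsRun (A : TimedAutomaton) : Hist → Prop
  | [] => True
  | (l, s) :: ρ => A.IsRun ρ ∧ A.Step (A.last ρ) l s

/-- A positive amount of time can elapse in the state `s`. -/
def TimedAutomaton.CanWait (A : TimedAutomaton) (s : AState) : Prop :=
  ∃ d : ℝ≥0, 0 < d ∧ ∃ s', A.Step s (.delay d) s'

/-- What a controller can enable: a controllable action, or letting time pass (the symbol `λ`). -/
inductive Command where
  | enable (a : ℕ)
  | wait

/-- Controllers assign a set of commands to each run. The empty set also stands for "undefined";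
the values on histories that are not runs are irrelevant. -/
abbrev Controller := Hist → Set Command

/-- `C` is a controller for `A` with the controllable actions `ctrl`: it enables only
controllable actions that are possible, it lets time pass only where time can pass, and where time
can pass it does not choose the empty set (it may stop time only in favour of some controllable
action). -/
structure IsController (A : TimedAutomaton) (ctrl : List ℕ) (C : Controller) : Prop where
  enable_possible : ∀ ρ a, A.IsRun ρ → Command.enable a ∈ C ρ →
    a ∈ ctrl ∧ ∃ s', A.Step (A.last ρ) (.act (some a)) s'
  wait_possible : ∀ ρ, A.IsRun ρ → Command.wait ∈ C ρ → A.CanWait (A.last ρ)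
  nonblocking : ∀ ρ, A.IsRun ρ → A.CanWait (A.last ρ) → (C ρ).Nonempty

/-- After the run `ρ` of `A`, the controller `C` permits a step with the given label.
Uncontrollable actions (and `ε`) are always permitted. -/
def Permits (A : TimedAutomaton) (ctrl : List ℕ) (C : Controller) (ρ : Hist) : Label → Prop
  | .act none => True
  | .act (some a) => a ∉ ctrl ∨ Command.enable a ∈ C ρ
  | .delay d => ∀ d', 0 ≤ d' → d' < d →
      ∃ s', A.Step (A.last ρ) (.delay d') s' ∧ Command.wait ∈ C ((.delay d', s') :: ρ)

/-- The controlled system `C(A)`: its states are histories, of which exactly the runs of `A` that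
respect `C` are reachable. -/
def controlled (A : TimedAutomaton) (ctrl : List ℕ) (C : Controller) : TTS where
  State := Hist
  start := []
  trans ρ l ρ' := ∃ s', ρ' = (l, s') :: ρ ∧ A.Step (A.last ρ) l s' ∧ Permits A ctrl C ρ l

/-! ### The SNNI control problem and the SNNI controller synthesis problem -/

/-- An input of the two problems: a timed automaton, its high-level actions (all other actions
are low-level) and its controllable actions (all other actions are uncontrollable). -/
structure Input where
  aut : TimedAutomaton
  high : List ℕ
  ctrl : List ℕ

/-- `C` is a controller such that `C(A)` is SNNI. -/
def IsWitness (I : Input) (C : Controller) : Prop :=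
  IsController I.aut I.ctrl C ∧ (controlled I.aut I.ctrl C).IsSNNI I.high

/-- The SNNI control problem: is there a controller `C` such that `C(A)` is SNNI? -/
def SNNIControl (I : Input) : Prop := ∃ C : Controller, IsWitness I C

/-- `f` solves the SNNI controller synthesis problem, where controllers are described by elements
of `K`, which are read through `decode`: it returns a description of a witness if there is a
witness, and reports that there is none (`none`) otherwise. -/
def SolvesSNNISynthesis {K : Type} (decode : Input → K → Controller) (f : Input → Option K) :
    Prop :=
  ∀ I, (SNNIControl I → ∃ k, f I = some k ∧ IsWitness I (decode I k)) ∧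
    (¬ SNNIControl I → f I = none)

/-! ### The encoding of inputs

Each of the structures above is identified with the tuple of its fields, and tuples and lists of
natural numbers carry the standard effective encoding. -/

def Cmp.equiv : Cmp ≃ Fin 5 where
  toFun
    | .lt => 0
    | .le => 1
    | .eq => 2
    | .ge => 3
    | .gt => 4
  invFun
    | 0 => .lt
    | 1 => .le
    | 2 => .eq
    | 3 => .ge
    | 4 => .gt
  left_inv c := by cases c <;> rfl
  right_inv i := by fin_cases i <;> rfl

instance : Primcodable Cmp := Primcodable.ofEquiv _ Cmp.equiv

def Atom.equiv : Atom ≃ ℕ × Cmp × ℕ where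
  toFun g := (g.clock, g.cmp, g.bound)
  invFun t := ⟨t.1, t.2.1, t.2.2⟩
  left_inv _ := rfl
  right_inv _ := rfl

instance : Primcodable Atom := Primcodable.ofEquiv _ Atom.equiv

def InvAtom.equiv : InvAtom ≃ ℕ × ℕ × Bool × ℕ where
  toFun g := (g.loc, g.clock, g.strict, g.bound)
  invFun t := ⟨t.1, t.2.1, t.2.2.1, t.2.2.2⟩
  left_inv _ := rfl
  right_inv _ := rfl

instance : Primcodable InvAtom := Primcodable.ofEquiv _ InvAtom.equiv

def Edge.equiv : Edge ≃ ℕ × List Atom × Option ℕ × List ℕ × ℕ where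
  toFun e := (e.src, e.guard, e.label, e.reset, e.tgt)
  invFun t := ⟨t.1, t.2.1, t.2.2.1, t.2.2.2.1, t.2.2.2.2⟩
  left_inv _ := rfl
  right_inv _ := rfl

instance : Primcodable Edge := Primcodable.ofEquiv _ Edge.equiv

def TimedAutomaton.equiv : TimedAutomaton ≃ ℕ × List Edge × List InvAtom where
  toFun A := (A.start, A.edges, A.inv)
  invFun t := ⟨t.1, t.2.1, t.2.2⟩
  left_inv _ := rfl
  right_inv _ := rfl

instance : Primcodable TimedAutomaton := Primcodable.ofEquiv _ TimedAutomaton.equiv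

def Input.equiv : Input ≃ TimedAutomaton × List ℕ × List ℕ where
  toFun I := (I.aut, I.high, I.ctrl)
  invFun t := ⟨t.1, t.2.1, t.2.2⟩
  left_inv _ := rfl
  right_inv _ := rfl

instance : Primcodable Input := Primcodable.ofEquiv _ Input.equiv

end TimedSNNI

/-!
Without controllable actions, a controller must let time pass wherever it can, so that the SNNI
control problem asks whether the automaton itself is SNNI (`snniControl_iff_of_ctrl_nil`). This
is undecidable, by a reduction of the complement of a halting problem in the style of Alur and
Dill's proof that universality of timed automata is undecidable. A solution of the synthesis problem
would decide the control problem, whatever the controllers it returns look like, because it tells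
whether there is one.

The starting point is a fixed Turing machine whose halting problem on the inputs `a b cⁿ` is
undecidable (`exists_undecidable_machine`). A halting computation is written as a word of rows of
equal length `p`, one for each configuration, with enough blanks on both sides. A cell of a row
holds its content before and after the step. That a row describes a step is then a regular
property, checked by a finite automaton (`Arc`), and what remains is that each cell reads what the
cell `p` letters before has written (`Periodic`, `eval_dom_iff_exists_periodic`).

The timed automaton (`Trans`) can do a high-level action and then generate any word that the row
automaton accepts, at strictly increasing times, with every row beginning at an integer time. Or it
can silently become an error detector, which reads the final letter `hash` only after it has found
that some letter has a wrong counterpart or none one time unit later, or that some letter has no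
counterpart one time unit before. Hiding the high-level action yields both languages and
forbidding it only the second, so the automaton is SNNI if and only if every generated word
contains an error. A generated word without errors repeats its times after one time unit, hence is
periodic; conversely, a periodic word is generated with all delays equal to `1 / p`
(`reads_gen_subset_iff`). Thus the automaton is SNNI if and only if the machine does not halt
(`Realizes.snniControl_iff`), and it can be computed from `n` (`exists_primrec_realizes`).
-/

namespace TimedSNNI

open Turing

/-! ### A Turing machine with an undecidable halting problem -/

/-- The powers of two serve as inputs because their binary codes are unary up to the last digit. -/
theorem trNat_two_pow (n : ℕ) :
    PartrecToTM2.trNat (2 ^ n) =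
      List.replicate n PartrecToTM2.Γ'.bit0 ++ [PartrecToTM2.Γ'.bit1] := by
  have key : ∀ n : ℕ, ∃ p : PosNum, ((2 ^ n : ℕ) : Num) = Num.pos p ∧
      PartrecToTM2.trPosNum p =
        List.replicate n PartrecToTM2.Γ'.bit0 ++ [PartrecToTM2.Γ'.bit1] := by
    intro n
    induction n with
    | zero => exact ⟨PosNum.one, rfl, rfl⟩
    | succ n ih =>
      obtain ⟨p, hp, hl⟩ := ih
      refine ⟨p.bit0, ?_, ?_⟩
      · have h2 : ((2 ^ (n + 1) : ℕ) : Num) = ((2 ^ n : ℕ) : Num) + ((2 ^ n : ℕ) : Num) := by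
          rw [← Nat.cast_add]; congr 1; ring
        rw [h2, hp, Num.bit0_of_bit0]; rfl
      · rw [PartrecToTM2.trPosNum, hl]; rfl
  obtain ⟨p, hp, hl⟩ := key n
  rw [PartrecToTM2.trNat, hp]
  exact hl

/-- A partial recursive function whose domain, restricted to the powers of two, is the halting
problem. -/
theorem exists_partrec_two_pow :
    ∃ g : ℕ →. ℕ, Partrec g ∧ ¬ ComputablePred fun n => (g (2 ^ n)).Dom := by
  have hpow : Primrec₂ fun m k : ℕ => decide (2 ^ k = m) := by
    have h : Primrec₂ fun m k : ℕ => 2 ^ k :=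
      (Primrec₂.unpaired'.1 Nat.Primrec.pow).comp (Primrec.const 2) Primrec.snd
    exact (Primrec.eq.comp h Primrec.fst).decide
  let g : ℕ →. ℕ := fun m =>
    (Nat.rfind fun k => Part.some (decide (2 ^ k = m))).bind fun k =>
      Nat.Partrec.Code.eval (Denumerable.ofNat Nat.Partrec.Code k) 0
  refine ⟨g, ?_, fun h => ?_⟩
  · refine Partrec.bind (Partrec.rfind hpow.to_comp.partrec₂) ?_
    exact Nat.Partrec.Code.eval_part.comp ((Computable.ofNat _).comp Computable.snd)
      (Computable.const 0)
  · have hg : ∀ n, (g (2 ^ n)).Dom ↔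
        (Nat.Partrec.Code.eval (Denumerable.ofNat Nat.Partrec.Code n) 0).Dom := by
      intro n
      have : (Nat.rfind fun k => Part.some (decide (2 ^ k = 2 ^ n))) = Part.some n := by
        refine Part.eq_some_iff.2 (Nat.mem_rfind.2 ⟨by simp, fun {m} hm => ?_⟩)
        have : (2 : ℕ) ^ m ≠ 2 ^ n := (Nat.pow_lt_pow_right (by norm_num) hm).ne
        simp [this]
      simp only [g, this, Part.bind_some]
    apply ComputablePred.halting_problem 0
    obtain ⟨_, hc⟩ := h
    have := hc.comp (Computable.encode (α := Nat.Partrec.Code))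
    refine ComputablePred.of_eq (p := fun c => (g (2 ^ Encodable.encode c)).Dom)
      ⟨fun c => inferInstance, this⟩ fun c => ?_
    rw [hg, Denumerable.ofNat_encode]

instance : Fintype PartrecToTM2.K' :=
  ⟨{.main, .rev, .aux, .stack}, fun k => by cases k <;> decide⟩

/-- A machine can be restricted to a finite set of states that is closed under its steps. -/
theorem restrict_tm0_eval_dom {Γ Λ : Type} [Inhabited Γ] [Inhabited Λ] (M : TM0.Machine Γ Λ)
    {S : Finset Λ} (hS : TM0.Supports M S) :
    ∃ (_ : Inhabited S) (M' : TM0.Machine Γ S), ∀ l,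
      (StateTransition.eval (TM0.step M') (TM0.init l)).Dom ↔
        (StateTransition.eval (TM0.step M) (TM0.init l)).Dom := by
  classical
  let _ : Inhabited S := ⟨⟨default, hS.1⟩⟩
  let g₁ : PointedMap Λ S := ⟨fun q => if h : q ∈ S then ⟨q, h⟩ else default, by
    have : (default : Λ) ∈ S := hS.1
    simp only [this, dif_pos]; rfl⟩
  let f : PointedMap Γ Γ := ⟨id, rfl⟩
  have hr := TM0.Machine.map_respects M f f g₁ (fun q : S => (q : Λ)) hS (fun _ => rfl)
    (fun q hq => by
      have hq' : q ∈ S := hq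
      change (((if h : q ∈ S then ⟨q, h⟩ else default) : S) : Λ) = q
      rw [dif_pos hq'])
  refine ⟨inferInstance, M.map f f g₁ (fun q : S => (q : Λ)), fun l => ?_⟩
  refine StateTransition.tr_eval_dom hr ⟨hS.1, ?_⟩
  rw [TM0.map_init]
  congr 1
  exact List.map_id l

/-- Some finite Turing machine has an undecidable halting problem already on the inputs `a b cⁿ`. The
input `2ⁿ` gets this shape when it is put on a tape as a stack with its bottom first. -/
theorem exists_undecidable_machine :
    ∃ (Γ Λ : Type) (_ : Inhabited Γ) (_ : Inhabited Λ) (_ : Finite Γ) (_ : Finite Λ)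
      (M : TM0.Machine Γ Λ) (a b c : Γ), ¬ ComputablePred fun n : ℕ =>
        (StateTransition.eval (TM0.step M) (TM0.init (a :: b :: List.replicate n c))).Dom := by
  obtain ⟨g, hg, hund⟩ := exists_partrec_two_pow
  obtain ⟨code, hcode⟩ := ToPartrec.Code.exists_code (Nat.Partrec'.part_iff₁.2 hg)
  let _ : Inhabited PartrecToTM2.Λ' := ⟨PartrecToTM2.trNormal code PartrecToTM2.Cont'.halt⟩
  have hsupp : TM2.Supports PartrecToTM2.tr
      (PartrecToTM2.codeSupp code PartrecToTM2.Cont'.halt) :=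
    PartrecToTM2.tr_supports code PartrecToTM2.Cont'.halt
  have hsupp0 := TM1to0.tr_supports _ (TM2to1.tr_supports _ hsupp)
  obtain ⟨hinh, M, hM⟩ := restrict_tm0_eval_dom _ hsupp0
  let L : PartrecToTM2.Γ' → TM2to1.Γ' PartrecToTM2.K' (fun _ => PartrecToTM2.Γ') := fun s =>
    (false, Function.update (fun _ => none) PartrecToTM2.K'.main (some s))
  refine ⟨_, _, inferInstance, hinh, inferInstance, inferInstance, M,
    (true, (L .cons).2), L .bit1, L .bit0, fun h => hund (h.of_eq fun n => ?_)⟩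
  have hin : (true, (L .cons).2) :: L .bit1 :: List.replicate n (L .bit0) =
      TM2to1.trInit PartrecToTM2.K'.main (PartrecToTM2.trList [2 ^ n]) := by
    have hl : (PartrecToTM2.trList [2 ^ n]).reverse =
        .cons :: .bit1 :: List.replicate n .bit0 := by
      simp [PartrecToTM2.trList, trNat_two_pow]
    unfold TM2to1.trInit
    rw [hl, ← List.map_replicate]
    rfl
  refine (hM _).trans ((iff_of_eq (congrArg (fun l => (TM0.eval (TM1to0.tr
    (TM2to1.tr PartrecToTM2.tr)) l).Dom) hin)).trans ?_)
  have h0 := congrArg Part.Dom (TM1to0.tr_eval (TM2to1.tr PartrecToTM2.tr)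
    (TM2to1.trInit PartrecToTM2.K'.main (PartrecToTM2.trList [2 ^ n])))
  have h1 := TM2to1.tr_eval_dom PartrecToTM2.tr PartrecToTM2.K'.main
    (PartrecToTM2.trList [2 ^ n])
  have h2 := PartrecToTM2.tr_eval code [2 ^ n]
  have h3 : (TM2.init PartrecToTM2.K'.main (PartrecToTM2.trList [2 ^ n]) :
      TM2.Cfg (fun _ : PartrecToTM2.K' => PartrecToTM2.Γ') PartrecToTM2.Λ'
        (Option PartrecToTM2.Γ')) = PartrecToTM2.init code [2 ^ n] := by
    unfold TM2.init PartrecToTM2.init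
    congr 1
    funext k
    cases k <;> rfl
  have h4 := hcode ⟨[2 ^ n], rfl⟩
  rw [h0, h1]
  change (StateTransition.eval _ (TM2.init _ _)).Dom ↔ _
  rw [h3, h2]
  change (ToPartrec.Code.eval code [2 ^ n]).Dom ↔ _
  rw [h4]
  rfl

/-! ### Computations as periodic words -/

/-- `Path R s u t`: the word `u` labels a path from `s` to `t` in the labelled graph `R`. -/
def Path {σ α : Type} (R : σ → α → σ → Prop) : σ → List α → σ → Prop
  | s, [], t => s = t
  | s, a :: u, t => ∃ m, R s a m ∧ Path R m u t

theorem Path.append {σ α : Type} {R : σ → α → σ → Prop} {s m t : σ} {u v : List α}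
    (h : Path R s u m) (h' : Path R m v t) : Path R s (u ++ v) t := by
  induction u generalizing s with
  | nil => cases h; exact h'
  | cons a u ih =>
    obtain ⟨s', ha, hu⟩ := h
    exact ⟨s', ha, ih hu⟩

theorem path_append_iff {σ α : Type} {R : σ → α → σ → Prop} {s t : σ} {u v : List α} :
    Path R s (u ++ v) t ↔ ∃ m, Path R s u m ∧ Path R m v t := by
  refine ⟨fun h => ?_, fun ⟨m, h, h'⟩ => h.append h'⟩
  induction u generalizing s with
  | nil => exact ⟨s, rfl, h⟩
  | cons a u ih =>
    obtain ⟨s', ha, hu⟩ := h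
    obtain ⟨m, h1, h2⟩ := ih hu
    exact ⟨m, ⟨s', ha, h1⟩, h2⟩

/-- The content of a tape cell in a configuration: a symbol, and whether the head is there. -/
abbrev Content (Γ : Type) := Γ × Bool

/-- The letters of the words that describe computations. A word consists of rows of equal length,
one for each configuration. A row begins with `tick`, and `hash` follows the last row. The letter
`cell (r, w)` stands for a cell with content `r` before and content `w` after the step which the
row describes. -/
inductive Letter (Γ : Type) where
  | tick
  | hash
  | cell (c : Content Γ × Content Γ)

/-- The letters `tick` and `hash`, which are to occur at integer times. -/
def Letter.IsMark {Γ : Type} : Letter Γ → Prop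
  | cell _ => False
  | _ => True

/-- The states of the finite automaton that checks the rows: `start`, `pad`, `second` and `input k`
(`k` letters of the input are still missing) are used in the first row, `scan q` is the state
before the head is found when the machine is in state `q`, and the states that follow tell
what has been seen or guessed in the row. -/
inductive Node (Γ Λ : Type) where
  | start
  | pad
  | second
  | input (k : ℕ)
  | scan (q : Λ)
  | leave (q : Λ) (x : Γ)
  | arrive (q : Λ)
  | done (q : Λ)
  | halted
  | final

variable {Γ Λ : Type} [Inhabited Γ] [Inhabited Λ]

/-- The transitions of the automaton that checks the rows. The first row writes the initial
configuration for the input `a b cⁿ` with arbitrarily many blanks on both sides; every other row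
describes one step of `M`. The read parts of the first row are meaningless and hence fixed. -/
inductive Arc (M : TM0.Machine Γ Λ) (a b c : Γ) (n : ℕ) :
    Node Γ Λ → Letter Γ → Node Γ Λ → Prop
  | start : Arc M a b c n .start .tick .pad
  | pad : Arc M a b c n .pad (.cell ((default, false), (default, false))) .pad
  | first : Arc M a b c n .pad (.cell ((default, false), (a, true))) .second
  | second : Arc M a b c n .second (.cell ((default, false), (b, false))) (.input n)
  | input {k : ℕ} : k < n →
      Arc M a b c n (.input (k + 1)) (.cell ((default, false), (c, false))) (.input k)
  | fill : Arc M a b c n (.input 0) (.cell ((default, false), (default, false))) (.input 0)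
  | run : Arc M a b c n (.input 0) .tick (.scan default)
  | skip {q : Λ} {x : Γ} : Arc M a b c n (.scan q) (.cell ((x, false), (x, false))) (.scan q)
  | write {q q' : Λ} {x y : Γ} : M q x = some (q', .write y) →
      Arc M a b c n (.scan q) (.cell ((x, true), (y, true))) (.done q')
  | right {q q' : Λ} {x : Γ} : M q x = some (q', .move .right) →
      Arc M a b c n (.scan q) (.cell ((x, true), (x, false))) (.arrive q')
  | arrive {q : Λ} {x : Γ} : Arc M a b c n (.arrive q) (.cell ((x, false), (x, true))) (.done q)
  | left {q q' : Λ} {x y : Γ} : M q x = some (q', .move .left) →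
      Arc M a b c n (.scan q) (.cell ((y, false), (y, true))) (.leave q' x)
  | leave {q : Λ} {x : Γ} : Arc M a b c n (.leave q x) (.cell ((x, true), (x, false))) (.done q)
  | halt {q : Λ} {x : Γ} : M q x = none →
      Arc M a b c n (.scan q) (.cell ((x, true), (x, true))) .halted
  | rest {q : Λ} {x : Γ} : Arc M a b c n (.done q) (.cell ((x, false), (x, false))) (.done q)
  | restHalted {x : Γ} : Arc M a b c n .halted (.cell ((x, false), (x, false))) .halted
  | next {q : Λ} : Arc M a b c n (.done q) .tick (.scan q)
  | finish : Arc M a b c n .halted .hash .final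

/-- The letters `tick` and `hash` occur exactly at the multiples of `p`, and each cell reads what
the cell `p` positions before has written. -/
structure Periodic (p : ℕ) (u : List (Letter Γ)) : Prop where
  mark : ∀ i s, u[i]? = some s → (s.IsMark ↔ p ∣ i)
  copy : ∀ i c c', u[i]? = some (.cell c) → u[i + p]? = some (.cell c') → c.2 = c'.1

omit [Inhabited Γ] in
theorem Periodic.drop {p : ℕ} {u v : List (Letter Γ)} (h : Periodic p (u ++ v))
    (hu : u.length = p) : Periodic p v := by
  have key : ∀ i, v[i]? = (u ++ v)[i + p]? := fun i => by
    rw [List.getElem?_append_right (by omega)]; congr 1; omega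
  refine ⟨fun i s hs => ?_, fun i c c' hc hc' => ?_⟩
  · rw [h.mark (i + p) s (by rw [← key, hs]), Nat.dvd_add_self_right]
  · exact h.copy (i + p) c c' (by rw [← key, hc]) (by rw [← key, hc'])

/-- The word of a row. -/
def row (cs : List (Content Γ × Content Γ)) : List (Letter Γ) := .tick :: cs.map .cell

omit [Inhabited Γ] in
theorem length_row (cs : List (Content Γ × Content Γ)) : (row cs).length = cs.length + 1 := by
  simp [row]

omit [Inhabited Γ] in
theorem row_getElem?_succ (cs : List (Content Γ × Content Γ)) (i : ℕ) :
    (row cs)[i + 1]? = cs[i]?.map .cell := by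
  simp [row]

omit [Inhabited Γ] in
/-- The row before a mark has length `p`: its length is a multiple of `p`, and no cell stands at a
multiple of `p`. -/
theorem Periodic.length_row {p : ℕ} (hp : 0 < p) {cs : List (Content Γ × Content Γ)}
    {s : Letter Γ} {v : List (Letter Γ)} (hs : s.IsMark) (h : Periodic p (row cs ++ s :: v)) :
    (row cs).length = p := by
  have h1 : p ∣ (row cs).length :=
    (h.mark (row cs).length s (by simp)).1 hs
  have h2 := Nat.le_of_dvd (by rw [TimedSNNI.length_row]; omega) h1
  by_contra hne
  obtain ⟨j, rfl⟩ : ∃ j, p = j + 1 := ⟨p - 1, by omega⟩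
  have hj : j < cs.length := by rw [TimedSNNI.length_row] at *; omega
  refine (h.mark (j + 1) (.cell cs[j]) ?_).2 dvd_rfl
  rw [List.getElem?_append_left (by omega), row_getElem?_succ, List.getElem?_eq_getElem hj]
  rfl

omit [Inhabited Γ] in
theorem Periodic.copy_row {p : ℕ} {cs cs' : List (Content Γ × Content Γ)}
    {v : List (Letter Γ)} (h : Periodic p (row cs ++ (row cs' ++ v)))
    (hcs : (row cs).length = p) (hcs' : (row cs').length = p) :
    cs.map Prod.snd = cs'.map Prod.fst := by
  rw [TimedSNNI.length_row] at hcs hcs'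
  refine List.ext_getElem (by simp; omega) fun i h1 h2 => ?_
  simp only [List.length_map] at h1 h2
  simp only [List.getElem_map]
  refine h.copy (i + 1) _ _ ?_ ?_
  · rw [List.getElem?_append_left (by simp [row]; omega), row_getElem?_succ,
      List.getElem?_eq_getElem h1]
    rfl
  · rw [List.getElem?_append_right (by simp [row]; omega),
      List.getElem?_append_left (by simp [row]; omega),
      show i + 1 + p - (row cs).length = i + 1 by rw [TimedSNNI.length_row]; omega,
      row_getElem?_succ, List.getElem?_eq_getElem h2]
    rfl

omit [Inhabited Γ] in
theorem Periodic.hash {p : ℕ} : Periodic p [(.hash : Letter Γ)] := by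
  refine ⟨fun i s hs => ?_, fun i c c' hc => ?_⟩
  · obtain _ | i := i
    · cases hs; simp [Letter.IsMark]
    · simp at hs
  · obtain _ | i := i <;> simp at hc

omit [Inhabited Γ] in
theorem Periodic.row_append {p : ℕ} {cs : List (Content Γ × Content Γ)} {v : List (Letter Γ)}
    (h : Periodic p v) (hcs : (row cs).length = p)
    (hcopy : ∀ i c c', cs[i]? = some c → v[i + 1]? = some (.cell c') → c.2 = c'.1) :
    Periodic p (row cs ++ v) := by
  have hright : ∀ i, (row cs ++ v)[i + p]? = v[i]? := fun i => by
    rw [List.getElem?_append_right (by omega)]; congr 1; omega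
  refine ⟨fun i s hs => ?_, fun i c c' hc hc' => ?_⟩
  · rcases lt_or_ge i p with hi | hi
    · rw [List.getElem?_append_left (by omega)] at hs
      obtain _ | i := i
      · simp only [row, List.getElem?_cons_zero, Option.some.injEq] at hs
        subst hs; simp [Letter.IsMark]
      · rw [row_getElem?_succ, Option.map_eq_some_iff] at hs
        obtain ⟨c, -, rfl⟩ := hs
        exact ⟨False.elim, fun hd => absurd (Nat.le_of_dvd (by omega) hd) (by omega)⟩
    · obtain ⟨j, rfl⟩ := Nat.exists_eq_add_of_le' hi
      rw [hright] at hs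
      rw [h.mark j s hs, Nat.dvd_add_self_right]
  · rw [hright] at hc'
    rcases lt_or_ge i p with hi | hi
    · rw [List.getElem?_append_left (by omega)] at hc
      obtain _ | i := i
      · simp [row] at hc
      · rw [row_getElem?_succ, Option.map_eq_some_iff] at hc
        obtain ⟨d, hd, hdc⟩ := hc
        cases hdc
        exact hcopy i _ _ hd hc'
    · obtain ⟨j, rfl⟩ := Nat.exists_eq_add_of_le' hi
      rw [hright] at hc
      exact h.copy j c c' hc hc'

/-- The contents of the cells of a configuration whose head reads `x`; `X` lists the symbols to
the left of the head, nearest first, and `Y` those to the right. -/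
def contents (X : List Γ) (x : Γ) (Y : List Γ) : List (Content Γ) :=
  X.reverse.map (·, false) ++ (x, true) :: Y.map (·, false)

omit [Inhabited Γ] in
theorem length_contents (X : List Γ) (x : Γ) (Y : List Γ) :
    (contents X x Y).length = X.length + Y.length + 1 := by
  simp [contents]; omega

/-- The configuration of a machine with blanks outside of the listed symbols. -/
def config (q : Λ) (X : List Γ) (x : Γ) (Y : List Γ) : TM0.Cfg Γ Λ :=
  ⟨q, ⟨x, ListBlank.mk X, ListBlank.mk Y⟩⟩

section Rows

variable {M : TM0.Machine Γ Λ} {a b c : Γ} {n : ℕ}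

theorem path_done {q : Λ} {t : Node Γ Λ} {cs : List (Content Γ × Content Γ)} {Y : List Γ}
    (h : Path (Arc M a b c n) (.done q) (cs.map .cell) t)
    (hcs : cs.map Prod.fst = Y.map (·, false)) :
    t = .done q ∧ cs.map Prod.snd = Y.map (·, false) := by
  induction cs generalizing Y with
  | nil =>
    obtain _ | ⟨y, Y⟩ := Y
    · exact ⟨h.symm, rfl⟩
    · simp at hcs
  | cons d cs ih =>
    obtain _ | ⟨y, Y⟩ := Y
    · simp at hcs
    obtain ⟨m, ha, hp⟩ := h
    simp only [List.map_cons, List.cons.injEq] at hcs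
    cases ha
    obtain ⟨h1, h2⟩ := ih hp hcs.2
    exact ⟨h1, by simp [h2, ← hcs.1]⟩

theorem path_halted {t : Node Γ Λ} {cs : List (Content Γ × Content Γ)}
    (h : Path (Arc M a b c n) .halted (cs.map .cell) t) : t = .halted := by
  induction cs with
  | nil => exact h.symm
  | cons d cs ih =>
    obtain ⟨m, ha, hp⟩ := h
    cases ha
    exact ih hp

/-- What a row can do that starts in `scan q` and ends where a mark can follow: `xs` lists the
symbols to the left of the head from left to right. -/
theorem path_scan {q : Λ} {t : Node Γ Λ} {cs : List (Content Γ × Content Γ)}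
    {xs : List Γ} {x : Γ} {Y : List Γ}
    (h : Path (Arc M a b c n) (.scan q) (cs.map .cell) t)
    (hcs : cs.map Prod.fst = xs.map (·, false) ++ (x, true) :: Y.map (·, false))
    (ht : ∃ s t', Arc M a b c n t s t' ∧ s.IsMark) :
    (t = .halted ∧ M q x = none) ∨
    (∃ q' y, t = .done q' ∧ M q x = some (q', .write y) ∧
      cs.map Prod.snd = xs.map (·, false) ++ (y, true) :: Y.map (·, false)) ∨
    (∃ q' y Y', t = .done q' ∧ M q x = some (q', .move .right) ∧ Y = y :: Y' ∧
      cs.map Prod.snd = xs.map (·, false) ++ (x, false) :: (y, true) :: Y'.map (·, false)) ∨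
    (∃ q' y xs', t = .done q' ∧ M q x = some (q', .move .left) ∧ xs = xs' ++ [y] ∧
      cs.map Prod.snd = xs'.map (·, false) ++ (y, true) :: (x, false) :: Y.map (·, false)) := by
  obtain ⟨s, t', hst, hs⟩ := ht
  induction xs generalizing cs with
  | nil =>
    obtain _ | ⟨⟨r, w⟩, cs⟩ := cs
    · simp at hcs
    obtain ⟨m, ha, hp⟩ := h
    simp only [List.map_cons, List.map_nil, List.nil_append, List.cons.injEq] at hcs
    obtain ⟨rfl, hcs⟩ := hcs
    cases ha with
    | write hM =>
      obtain ⟨rfl, h2⟩ := path_done hp hcs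
      exact .inr (.inl ⟨_, _, rfl, hM, by simp [h2]⟩)
    | right hM =>
      obtain _ | ⟨⟨r', w'⟩, cs⟩ := cs
      · cases hp; cases hst; cases hs
      obtain ⟨m, ha, hp⟩ := hp
      obtain _ | ⟨y, Y⟩ := Y
      · simp at hcs
      simp only [List.map_cons, List.cons.injEq] at hcs
      obtain ⟨rfl, hcs⟩ := hcs
      cases ha
      obtain ⟨rfl, h2⟩ := path_done hp hcs
      exact .inr (.inr (.inl ⟨_, _, _, rfl, hM, rfl, by simp [h2]⟩))
    | halt hM => exact .inl ⟨path_halted hp, hM⟩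
  | cons y xs ih =>
    obtain _ | ⟨⟨r, w⟩, cs⟩ := cs
    · simp at hcs
    obtain ⟨m, ha, hp⟩ := h
    simp only [List.map_cons, List.cons_append, List.cons.injEq] at hcs
    obtain ⟨rfl, hcs⟩ := hcs
    cases ha with
    | skip =>
      rcases ih hp hcs with h | ⟨q', z, h1, h2, h3⟩ | ⟨q', z, Y', h1, h2, h3, h4⟩ |
        ⟨q', z, xs', h1, h2, h3, h4⟩
      · exact .inl h
      · exact .inr (.inl ⟨q', z, h1, h2, by simp [h3]⟩)
      · exact .inr (.inr (.inl ⟨q', z, Y', h1, h2, h3, by simp [h4]⟩))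
      · exact .inr (.inr (.inr ⟨q', z, y :: xs', h1, h2, by simp [h3], by simp [h4]⟩))
    | left hM =>
      obtain _ | ⟨⟨r', w'⟩, cs⟩ := cs
      · cases hp; cases hst; cases hs
      obtain ⟨m, ha, hp⟩ := hp
      cases ha
      obtain _ | ⟨z, xs⟩ := xs
      · simp only [List.map_cons, List.map_nil, List.nil_append, List.cons.injEq,
          Prod.mk.injEq, and_true] at hcs
        obtain ⟨rfl, hcs⟩ := hcs
        obtain ⟨rfl, h2⟩ := path_done hp hcs
        exact .inr (.inr (.inr ⟨_, y, [], rfl, hM, rfl, by simp [h2]⟩))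
      · simp at hcs

/-- The machine halts after exactly `k` steps. -/
def HaltsIn (M : TM0.Machine Γ Λ) : ℕ → TM0.Cfg Γ Λ → Prop
  | 0, C => TM0.step M C = none
  | k + 1, C => ∃ C', TM0.step M C = some C' ∧ HaltsIn M k C'

theorem eval_dom_iff_haltsIn {C : TM0.Cfg Γ Λ} :
    (StateTransition.eval (TM0.step M) C).Dom ↔ ∃ k, HaltsIn M k C := by
  constructor
  · intro h
    obtain ⟨D, hD⟩ := Part.dom_iff_mem.1 h
    obtain ⟨h1, h2⟩ := StateTransition.mem_eval.1 hD
    induction h1 using Relation.ReflTransGen.head_induction_on with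
    | refl => exact ⟨0, h2⟩
    | head hs _ ih =>
      obtain ⟨k, hk⟩ := ih (Part.dom_iff_mem.2 ⟨D, StateTransition.mem_eval.2 ⟨‹_›, h2⟩⟩)
        (StateTransition.mem_eval.2 ⟨‹_›, h2⟩)
      exact ⟨k + 1, _, hs, hk⟩
  · rintro ⟨k, hk⟩
    suffices ∃ D, StateTransition.Reaches (TM0.step M) C D ∧ TM0.step M D = none by
      obtain ⟨D, hD⟩ := this
      exact Part.dom_iff_mem.2 ⟨D, StateTransition.mem_eval.2 hD⟩
    induction k generalizing C with
    | zero => exact ⟨C, .refl, hk⟩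
    | succ k ih =>
      obtain ⟨C', h1, h2⟩ := hk
      obtain ⟨D, h3, h4⟩ := ih h2
      exact ⟨D, .head h1 h3, h4⟩

theorem step_config_none {q : Λ} {X : List Γ} {x : Γ} {Y : List Γ} :
    TM0.step M (config q X x Y) = none ↔ M q x = none := by
  simp [TM0.step, config]

theorem step_config_write {q q' : Λ} {X : List Γ} {x y : Γ} {Y : List Γ}
    (h : M q x = some (q', .write y)) :
    TM0.step M (config q X x Y) = some (config q' X y Y) := by
  simp [TM0.step, config, h, Tape.write]

theorem step_config_right {q q' : Λ} {X : List Γ} {x y : Γ} {Y : List Γ}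
    (h : M q x = some (q', .move .right)) :
    TM0.step M (config q X x (y :: Y)) = some (config q' (x :: X) y Y) := by
  simp [TM0.step, config, h, Tape.move]

theorem step_config_left {q q' : Λ} {X : List Γ} {x y : Γ} {Y : List Γ}
    (h : M q x = some (q', .move .left)) :
    TM0.step M (config q (y :: X) x Y) = some (config q' X y (x :: Y)) := by
  simp [TM0.step, config, h, Tape.move]

/-- A row that reads the contents of a configuration and ends where a mark can follow either finds
the machine halted or writes the contents of the next configuration. -/
theorem row_sound {q : Λ} {t : Node Γ Λ} {cs : List (Content Γ × Content Γ)}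
    {X : List Γ} {x : Γ} {Y : List Γ}
    (h : Path (Arc M a b c n) (.scan q) (cs.map .cell) t)
    (hcs : cs.map Prod.fst = contents X x Y)
    (ht : ∃ s t', Arc M a b c n t s t' ∧ s.IsMark) :
    (t = .halted ∧ TM0.step M (config q X x Y) = none) ∨
    ∃ q' X' x' Y', t = .done q' ∧ cs.map Prod.snd = contents X' x' Y' ∧
      TM0.step M (config q X x Y) = some (config q' X' x' Y') := by
  rcases path_scan h hcs ht with ⟨h1, h2⟩ | ⟨q', z, h1, h2, h3⟩ | ⟨q', z, Y', h1, h2, rfl, h4⟩ |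
        ⟨q', z, xs', h1, h2, h3, h4⟩
  · exact .inl ⟨h1, step_config_none.2 h2⟩
  · exact .inr ⟨q', X, z, Y, h1, h3, step_config_write h2⟩
  · exact .inr ⟨q', x :: X, z, Y', h1, by rw [h4]; simp [contents], step_config_right h2⟩
  · obtain rfl : X = z :: xs'.reverse := by
      rw [← X.reverse_reverse, h3]; simp
    exact .inr ⟨q', xs'.reverse, z, x :: Y, h1, by rw [h4]; simp [contents],
      step_config_left h2⟩

/-- Conversely, a row exists for each step that does not leave the listed part of the tape. -/
theorem row_complete {q q' : Λ} {s : TM0.Stmt Γ} {X : List Γ} {x : Γ} {Y : List Γ}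
    (hX : X ≠ []) (hY : Y ≠ []) (hM : M q x = some (q', s)) :
    ∃ (cs : List (Content Γ × Content Γ)) (X' : List Γ) (x' : Γ) (Y' : List Γ),
      Path (Arc M a b c n) (.scan q) (cs.map .cell) (.done q') ∧
      cs.map Prod.fst = contents X x Y ∧ cs.map Prod.snd = contents X' x' Y' ∧
      TM0.step M (config q X x Y) = some (config q' X' x' Y') ∧
      X'.length + Y'.length = X.length + Y.length ∧
      X.length ≤ X'.length + 1 ∧ Y.length ≤ Y'.length + 1 := by
  have hskip : ∀ l : List Γ, Path (Arc M a b c n) (.scan q)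
      ((l.map fun y => ((y, false), (y, false))).map .cell) (.scan q) := by
    intro l
    induction l with
    | nil => rfl
    | cons y l ih => exact ⟨_, .skip, ih⟩
  have hrest : ∀ l : List Γ, Path (Arc M a b c n) (.done q')
      ((l.map fun y => ((y, false), (y, false))).map .cell) (.done q') := by
    intro l
    induction l with
    | nil => rfl
    | cons y l ih => exact ⟨_, .rest, ih⟩
  obtain ⟨⟨⟩⟩ | y := s
  · obtain _ | ⟨y, X⟩ := X
    · exact absurd rfl hX
    refine ⟨(X.reverse.map fun y => ((y, false), (y, false))) ++
      ((y, false), (y, true)) :: ((x, true), (x, false)) ::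
        (Y.map fun y => ((y, false), (y, false))), X, y, x :: Y, ?_, ?_, ?_,
      step_config_left hM, ?_, ?_, ?_⟩
    · rw [List.map_append]
      exact (hskip _).append ⟨_, .left hM, _, .leave, hrest _⟩
    · simp [contents, Function.comp_def]
    · simp [contents, Function.comp_def]
    all_goals simp <;> omega
  · obtain _ | ⟨y, Y⟩ := Y
    · exact absurd rfl hY
    refine ⟨(X.reverse.map fun y => ((y, false), (y, false))) ++
      ((x, true), (x, false)) :: ((y, false), (y, true)) ::
        (Y.map fun y => ((y, false), (y, false))), x :: X, y, Y, ?_, ?_, ?_,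
      step_config_right hM, ?_, ?_, ?_⟩
    · rw [List.map_append]
      exact (hskip _).append ⟨_, .right hM, _, .arrive, hrest _⟩
    · simp [contents, Function.comp_def]
    · simp [contents, Function.comp_def]
    all_goals simp <;> omega
  · refine ⟨(X.reverse.map fun y => ((y, false), (y, false))) ++
      ((x, true), (y, true)) :: (Y.map fun y => ((y, false), (y, false))), X, y, Y, ?_, ?_, ?_,
      step_config_write hM, rfl, by omega, by omega⟩
    · rw [List.map_append]
      exact (hskip _).append ⟨_, .write hM, hrest _⟩
    · simp [contents, Function.comp_def]
    · simp [contents, Function.comp_def]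

theorem row_halted {q : Λ} {X : List Γ} {x : Γ} {Y : List Γ} (hM : M q x = none) :
    ∃ cs : List (Content Γ × Content Γ), Path (Arc M a b c n) (.scan q) (cs.map .cell) .halted ∧
      cs.map Prod.fst = contents X x Y := by
  have hskip : ∀ l : List Γ, Path (Arc M a b c n) (.scan q)
      ((l.map fun y => ((y, false), (y, false))).map .cell) (.scan q) := by
    intro l
    induction l with
    | nil => rfl
    | cons y l ih => exact ⟨_, .skip, ih⟩
  have hrest : ∀ l : List Γ, Path (Arc M a b c n) .halted
      ((l.map fun y => ((y, false), (y, false))).map .cell) .halted := by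
    intro l
    induction l with
    | nil => rfl
    | cons y l ih => exact ⟨_, .restHalted, ih⟩
  refine ⟨(X.reverse.map fun y => ((y, false), (y, false))) ++
    ((x, true), (x, true)) :: (Y.map fun y => ((y, false), (y, false))), ?_, ?_⟩
  · rw [List.map_append]
    exact (hskip _).append ⟨_, .halt hM, hrest _⟩
  · simp [contents, Function.comp_def]

/-- A path to `final` has a first mark, since only a mark leads to `final`. -/
theorem exists_split_at_mark {t : Node Γ Λ} {v : List (Letter Γ)} (ht : t ≠ .final)
    (h : Path (Arc M a b c n) t v .final) :
    ∃ (cs : List (Content Γ × Content Γ)) (s : Letter Γ) (v' : List (Letter Γ))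
      (m m' : Node Γ Λ), v = cs.map .cell ++ s :: v' ∧ s.IsMark ∧
      Path (Arc M a b c n) t (cs.map .cell) m ∧ Arc M a b c n m s m' ∧
      Path (Arc M a b c n) m' v' .final := by
  induction v generalizing t with
  | nil => exact absurd h ht
  | cons s v ih =>
    obtain ⟨m, ha, hp⟩ := h
    obtain _ | _ | d := s
    · exact ⟨[], _, v, t, m, rfl, trivial, rfl, ha, hp⟩
    · exact ⟨[], _, v, t, m, rfl, trivial, rfl, ha, hp⟩
    · have hm : m ≠ .final := by rintro rfl; cases ha
      obtain ⟨cs, s, v', m1, m2, rfl, h2, h3, h4, h5⟩ := ih hm hp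
      exact ⟨d :: cs, s, v', m1, m2, rfl, h2, ⟨m, ha, h3⟩, h4, h5⟩

/-- If the cells `cs` of a row have written the contents of a configuration, then the rows that
follow describe the steps of the machine from there. -/
theorem haltsIn_of_path {p : ℕ} (hp : 0 < p) {q : Λ} {X : List Γ} {x : Γ} {Y : List Γ}
    {cs : List (Content Γ × Content Γ)} {v : List (Letter Γ)}
    (hper : Periodic p (row cs ++ .tick :: v)) (hcs : cs.map Prod.snd = contents X x Y)
    (h : Path (Arc M a b c n) (.scan q) v .final) : ∃ k, HaltsIn M k (config q X x Y) := by
  induction hv : v.length using Nat.strong_induction_on generalizing q X x Y cs v with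
  | _ N ih =>
    subst hv
    obtain ⟨ds, s, v', m, m', rfl, hs, h1, h2, h3⟩ := exists_split_at_mark (by simp) h
    have hl := hper.length_row hp (s := .tick) trivial
    have hper' : Periodic p (row ds ++ s :: v') := hper.drop hl
    have hl' := hper'.length_row hp hs
    have hds : ds.map Prod.fst = contents X x Y := by
      rw [← hcs]; exact (hper.copy_row (cs' := ds) (v := s :: v') hl hl').symm
    rcases row_sound h1 hds ⟨s, m', h2, hs⟩ with ⟨-, h4⟩ | ⟨q', X', x', Y', rfl, h4, h5⟩
    · exact ⟨0, h4⟩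
    · cases h2 with
      | rest => cases hs
      | next =>
        obtain ⟨k, hk⟩ := ih _ (by simp; omega) hper' h4 h3 rfl
        exact ⟨k + 1, _, h5, hk⟩

/-- Conversely, rows exist for a computation of `k` steps if at least `k` symbols are listed on
either side of the head, since the head then never leaves the listed part of the tape. -/
theorem path_of_haltsIn {k : ℕ} {q : Λ} {X : List Γ} {x : Γ} {Y : List Γ}
    (hX : k ≤ X.length) (hY : k ≤ Y.length) (h : HaltsIn M k (config q X x Y)) :
    ∃ cs v, cs.map Prod.fst = contents X x Y ∧
      Path (Arc M a b c n) (.scan q) (cs.map .cell ++ v) .final ∧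
      Periodic (X.length + Y.length + 2) (row cs ++ v) ∧ ∃ v', row cs ++ v = v' ++ [.hash] := by
  induction k generalizing q X x Y with
  | zero =>
    obtain ⟨cs, h1, h2⟩ := row_halted (a := a) (b := b) (c := c) (n := n) (X := X) (Y := Y)
      (step_config_none.1 h)
    have hl := congrArg List.length h2
    rw [length_contents, List.length_map] at hl
    refine ⟨cs, [.hash], h2, h1.append ⟨_, .finish, rfl⟩, ?_, _, rfl⟩
    refine Periodic.hash.row_append (by rw [length_row, hl]) fun i c c' _ h => ?_
    simp at h
  | succ k ih =>
    obtain ⟨C, hC, hk⟩ := h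
    rcases hM : M q x with _ | ⟨q', s⟩
    · rw [step_config_none.2 hM] at hC; cases hC
    obtain ⟨cs, X', x', Y', h1, h2, h3, h4, h5, h6, h7⟩ :=
      row_complete (a := a) (b := b) (c := c) (n := n) (X := X) (Y := Y)
        (by rintro rfl; simp at hX) (by rintro rfl; simp at hY) hM
    rw [h4] at hC
    cases hC
    obtain ⟨ds, v, g1, g2, g3, v', g4⟩ := ih (by omega) (by omega) hk
    have hl := congrArg List.length h2
    rw [length_contents, List.length_map] at hl
    refine ⟨cs, row ds ++ v, h2, h1.append ⟨_, .next, g2⟩, ?_, row cs ++ v', ?_⟩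
    · rw [h5] at g3
      refine g3.row_append (by rw [length_row, hl]) fun i d d' hd hd' => ?_
      have hlt : i < ds.length := by
        have h8 := congrArg List.length (h3.trans g1.symm)
        rw [List.length_map, List.length_map] at h8
        rw [← h8]
        exact (List.getElem?_eq_some_iff.1 hd).1
      rw [List.getElem?_append_left (by rw [length_row]; omega), row_getElem?_succ,
        Option.map_eq_some_iff] at hd'
      obtain ⟨e, he, hee⟩ := hd'
      cases hee
      have h9 := congrArg (·[i]?) (h3.trans g1.symm)
      simpa [hd, he] using h9
    · rw [g4, List.append_assoc]

/-- The cells of the first row, given the contents that they write. -/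
def inputCells (l : List (Content Γ)) : List (Content Γ × Content Γ) :=
  l.map fun d => ((default, false), d)

theorem path_input {k : ℕ} (hk : k ≤ n) {v : List (Letter Γ)}
    (h : Path (Arc M a b c n) (.input k) v .final) :
    ∃ j v', v = (inputCells ((List.replicate k c ++ List.replicate j default).map
        (·, false))).map .cell ++ .tick :: v' ∧
      Path (Arc M a b c n) (.scan default) v' .final := by
  induction v generalizing k with
  | nil => cases h
  | cons s v ih =>
    obtain ⟨m, ha, hp⟩ := h
    cases ha with
    | input hk' =>
      obtain ⟨j, v', rfl, h⟩ := ih hk'.le hp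
      exact ⟨j, v', rfl, h⟩
    | fill =>
      obtain ⟨j, v', rfl, h⟩ := ih hk hp
      exact ⟨j + 1, v', rfl, h⟩
    | run => exact ⟨0, v, rfl, hp⟩

theorem path_pad {v : List (Letter Γ)} (h : Path (Arc M a b c n) .pad v .final) :
    ∃ i j v', v = (inputCells (contents (List.replicate i default) a
        (b :: (List.replicate n c ++ List.replicate j default)))).map .cell ++ .tick :: v' ∧
      Path (Arc M a b c n) (.scan default) v' .final := by
  induction v with
  | nil => cases h
  | cons s v ih =>
    obtain ⟨m, ha, hp⟩ := h
    cases ha with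
    | pad =>
      obtain ⟨i, j, v', rfl, h⟩ := ih hp
      refine ⟨i + 1, j, v', ?_, h⟩
      simp only [contents, inputCells, List.reverse_replicate]
      simp [List.replicate_succ]
    | first =>
      obtain _ | ⟨s, v⟩ := v
      · cases hp
      obtain ⟨m, ha, hp⟩ := hp
      cases ha
      obtain ⟨j, v', rfl, h⟩ := path_input le_rfl hp
      exact ⟨0, j, v', by simp [contents, inputCells], h⟩

theorem pad_path {i j : ℕ} : Path (Arc M a b c n) .pad
    ((inputCells (contents (List.replicate i default) a
        (b :: (List.replicate n c ++ List.replicate j default)))).map .cell) (.input 0) := by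
  have h1 : ∀ j, Path (Arc M a b c n) (.input 0)
      ((inputCells ((List.replicate j default).map (·, false))).map .cell) (.input 0) := by
    intro j
    induction j with
    | zero => rfl
    | succ j ih => exact ⟨_, .fill, ih⟩
  have h2 : ∀ k ≤ n, Path (Arc M a b c n) (.input k)
      ((inputCells ((List.replicate k c ++ List.replicate j default).map (·, false))).map
        .cell) (.input 0) := by
    intro k hk
    induction k with
    | zero => simpa using h1 j
    | succ k ih => exact ⟨_, .input hk, ih (by omega)⟩
  have h3 : ∀ i, Path (Arc M a b c n) .pad
      ((inputCells ((List.replicate i default).map (·, false))).map .cell) .pad := by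
    intro i
    induction i with
    | zero => rfl
    | succ i ih => exact ⟨_, .pad, ih⟩
  rw [contents, List.reverse_replicate, inputCells, List.map_append, List.map_append]
  exact (h3 i).append ⟨_, .first, _, .second, h2 n le_rfl⟩

theorem listBlank_append_replicate (l : List Γ) (i : ℕ) :
    ListBlank.mk (l ++ List.replicate i default) = ListBlank.mk l :=
  (Quotient.sound (.inl ⟨i, rfl⟩) : ListBlank.mk l = _).symm

theorem config_padded (i j : ℕ) :
    config (default : Λ) (List.replicate i default) a
      (b :: (List.replicate n c ++ List.replicate j default)) =
        TM0.init (a :: b :: List.replicate n c) := by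
  have h1 := listBlank_append_replicate ([] : List Γ) i
  have h2 := listBlank_append_replicate (b :: List.replicate n c) j
  rw [List.nil_append] at h1
  rw [List.cons_append] at h2
  simp [config, TM0.init, Tape.mk₁, Tape.mk₂, Tape.mk', h1, h2]

/-- The machine halts on `a b cⁿ` if and only if some periodic word labels a path from `start` to
`final`. -/
theorem eval_dom_iff_exists_periodic :
    (StateTransition.eval (TM0.step M) (TM0.init (a :: b :: List.replicate n c))).Dom ↔
      ∃ p u, 0 < p ∧ Periodic p (u ++ [.hash]) ∧
        Path (Arc M a b c n) .start (u ++ [.hash]) .final := by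
  rw [eval_dom_iff_haltsIn]
  constructor
  · rintro ⟨k, hk⟩
    rw [← config_padded k k] at hk
    obtain ⟨cs, v, h1, h2, h3, v', h4⟩ := path_of_haltsIn (a := a) (b := b) (c := c) (n := n)
      (by simp) (by simp; omega) hk
    set X : List Γ := List.replicate k default
    set Y := b :: (List.replicate n c ++ List.replicate k default)
    refine ⟨X.length + Y.length + 2, row (inputCells (contents X a Y)) ++ v', by omega, ?_, ?_⟩
    · rw [List.append_assoc, ← h4]
      refine h3.row_append ?_ fun i d d' hd hd' => ?_
      · rw [length_row, inputCells, List.length_map, length_contents]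
      · have hlt : i < cs.length := by
          have h8 := congrArg List.length h1
          have h9 := (List.getElem?_eq_some_iff.1 hd).1
          rw [List.length_map] at h8
          rwa [inputCells, List.length_map, ← h8] at h9
        rw [List.getElem?_append_left (by rw [length_row]; omega), row_getElem?_succ,
          Option.map_eq_some_iff] at hd'
        obtain ⟨e, he, hee⟩ := hd'
        cases hee
        rw [inputCells, ← h1] at hd
        simp [he] at hd
        simp [← hd]
    · rw [List.append_assoc, ← h4]
      exact ⟨_, .start, pad_path.append ⟨_, .run, h2⟩⟩
  · rintro ⟨p, u, hp, hper, hpath⟩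
    obtain _ | ⟨s, w⟩ := u
    · obtain ⟨m, ha, -⟩ := hpath
      cases ha
    obtain ⟨m, ha, h⟩ := hpath
    cases ha
    obtain ⟨i, j, v, h1, h2⟩ := path_pad h
    rw [List.cons_append] at hper
    change Periodic p (.tick :: (w ++ [.hash])) at hper
    change w ++ [.hash] = _ at h1
    rw [h1] at hper
    rw [← config_padded i j]
    refine haltsIn_of_path hp (cs := inputCells _) hper ?_ h2
    simp [inputCells]

end Rows

/-! ### The timed automaton -/

/-- The locations of the timed automaton. The part `gen s` generates timed words along the paths
of the row automaton. The other part detects errors: in `watch` nothing has been guessed, `late l`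
waits for the letter that is due one time unit after an occurrence of `l`, `gap` and `between` wait
for a letter with no counterpart one time unit before, and an error has been found in `ok`. -/
inductive Loc (Γ Λ : Type) where
  | init
  | gen (s : Node Γ Λ)
  | watch
  | late (l : Letter Γ)
  | gap
  | between
  | ok

/-- The labels of the timed automaton. -/
inductive Lab (Γ : Type) where
  | eps
  | high
  | low (l : Letter Γ)

/-- `l'` must not stand one row below `l`. -/
def Mismatch {Γ : Type} (l l' : Letter Γ) : Prop :=
  ∃ c c', l = .cell c ∧ l' = .cell c' ∧ c.2 ≠ c'.1

section Core

variable {Γ Λ : Type} [Inhabited Γ] [Inhabited Λ]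

/-- The edges of the timed automaton: source, guard, label, reset clocks, target. In the generating
part the clock `0` measures the time since the last integer time and the clock `1` the time since
the last letter. In `late` the clock `0` measures the time since the guessed letter; in `between`
the clocks `0` and `1` measure the times since two consecutive letters. -/
inductive Trans (M : TM0.Machine Γ Λ) (a b c : Γ) (n : ℕ) :
    Loc Γ Λ → List Atom → Lab Γ → List ℕ → Loc Γ Λ → Prop
  | enter : Trans M a b c n .init [] .eps [] .watch
  | high : Trans M a b c n .init [] .high [] (.gen .start)
  | genMark {s t : Node Γ Λ} {l : Letter Γ} : Arc M a b c n s l t → l.IsMark →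
      Trans M a b c n (.gen s) [⟨0, .eq, 1⟩] (.low l) [0, 1] (.gen t)
  | genCell {s t : Node Γ Λ} {d : Content Γ × Content Γ} : Arc M a b c n s (.cell d) t →
      Trans M a b c n (.gen s) [⟨0, .lt, 1⟩, ⟨1, .gt, 0⟩] (.low (.cell d)) [1] (.gen t)
  | watch {l : Letter Γ} : l ≠ .hash → Trans M a b c n .watch [] (.low l) [] .watch
  | guess {l : Letter Γ} : l ≠ .hash → Trans M a b c n .watch [] (.low l) [0] (.late l)
  | wait {l l' : Letter Γ} : l' ≠ .hash →
      Trans M a b c n (.late l) [⟨0, .lt, 1⟩] (.low l') [] (.late l)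
  | wrong {l l' : Letter Γ} : Mismatch l l' →
      Trans M a b c n (.late l) [⟨0, .eq, 1⟩] (.low l') [] .ok
  | missing {l l' : Letter Γ} : Trans M a b c n (.late l) [⟨0, .gt, 1⟩] (.low l') [] .ok
  | guessGap {l : Letter Γ} : l ≠ .hash → Trans M a b c n .watch [] (.low l) [0] .gap
  | closeGap {l : Letter Γ} : l ≠ .hash → Trans M a b c n .gap [] (.low l) [1] .between
  | waitGap {l : Letter Γ} : l ≠ .hash → Trans M a b c n .between [] (.low l) [] .between
  | extra {l : Letter Γ} :
      Trans M a b c n .between [⟨0, .gt, 1⟩, ⟨1, .lt, 1⟩] (.low l) [] .ok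
  | ok {l : Letter Γ} : Trans M a b c n .ok [] (.low l) [] .ok

/-- Timed words over the low-level letters. -/
abbrev TimedWord (Γ : Type) := List (ℝ≥0 × Letter Γ)

/-- The timed word can be read from the location `x` with the valuation `v`. -/
def Reads (M : TM0.Machine Γ Λ) (a b c : Γ) (n : ℕ) : Loc Γ Λ → Val → TimedWord Γ → Prop
  | _, _, [] => True
  | x, v, (d, l) :: w => ∃ g R y, Trans M a b c n x g (.low l) R y ∧
      (∀ t ∈ g, t.holds (v.delay d)) ∧ Reads M a b c n y ((v.delay d).reset R) w

/-! ### The words that are generated -/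

/-- The marks occur at the integer times and the delays are positive; `z` is the time since the last
integer time. -/
def Timed {Γ : Type} : ℝ≥0 → TimedWord Γ → Prop
  | _, [] => True
  | z, (d, .cell _) :: w => z + d < 1 ∧ 0 < d ∧ Timed (z + d) w
  | z, (d, _) :: w => z + d = 1 ∧ Timed 0 w

theorem timed_cons_mark {Γ : Type} {z d : ℝ≥0} {l : Letter Γ} (hl : l.IsMark)
    {w : TimedWord Γ} : Timed z ((d, l) :: w) ↔ z + d = 1 ∧ Timed 0 w := by
  cases l
  · rfl
  · rfl
  · cases hl

variable {M : TM0.Machine Γ Λ} {a b c : Γ} {n : ℕ}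

/-- The generated timed words are those with the right times whose letters label a path of the row
automaton. -/
theorem reads_gen_iff {s : Node Γ Λ} {v : Val} (hv : v 1 = 0) {w : TimedWord Γ} :
    Reads M a b c n (.gen s) v w ↔
      Timed (v 0) w ∧ ∃ t, Path (Arc M a b c n) s (w.map Prod.snd) t := by
  induction w generalizing s v with
  | nil => exact ⟨fun _ => ⟨trivial, s, rfl⟩, fun _ => trivial⟩
  | cons e w ih =>
    obtain ⟨d, l⟩ := e
    constructor
    · rintro ⟨g, R, y, ht, hg, hr⟩
      cases ht with
      | genMark ha hl =>
        obtain ⟨h1, t, h2⟩ := (ih (by simp [Val.reset])).1 hr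
        refine ⟨(timed_cons_mark hl).2 ⟨?_, ?_⟩, t, _, ha, h2⟩
        · simpa [Atom.holds, Cmp.holds, Val.delay] using hg
        · simpa [Val.reset] using h1
      | genCell ha =>
        obtain ⟨h1, t, h2⟩ := (ih (by simp [Val.reset])).1 hr
        simp only [List.mem_cons, List.not_mem_nil, or_false, forall_eq_or_imp, forall_eq,
          Atom.holds, Cmp.holds, Val.delay, hv] at hg
        refine ⟨⟨by simpa using hg.1, by simpa using hg.2, ?_⟩, t, _, ha, h2⟩
        simpa [Val.reset, Val.delay] using h1
    · rintro ⟨h1, t, m, ha, h2⟩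
      by_cases hl : l.IsMark
      · rw [timed_cons_mark hl] at h1
        refine ⟨_, _, _, .genMark ha hl, ?_, (ih (by simp [Val.reset])).2 ⟨?_, t, h2⟩⟩
        · simpa [Atom.holds, Cmp.holds, Val.delay] using h1.1
        · simpa [Val.reset] using h1.2
      · obtain _ | _ | e := l
        · exact absurd trivial hl
        · exact absurd trivial hl
        obtain ⟨h3, h4, h5⟩ := h1
        refine ⟨_, _, _, .genCell ha, ?_, (ih (by simp [Val.reset])).2 ⟨?_, t, h2⟩⟩
        · simp only [List.mem_cons, List.not_mem_nil, or_false, forall_eq_or_imp, forall_eq,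
            Atom.holds, Cmp.holds, Val.delay, hv]
          exact ⟨by simpa using h3, by simpa using h4⟩
        · simpa [Val.reset, Val.delay] using h5

/-- The letter `hash` can only be the last one. -/
theorem hash_last {s t : Node Γ Λ} {u : List (Letter Γ)} (h : Path (Arc M a b c n) s u t)
    (hu : .hash ∈ u) : ∃ u', u = u' ++ [.hash] ∧ (∀ l ∈ u', l ≠ .hash) ∧ t = .final := by
  induction u generalizing s with
  | nil => simp at hu
  | cons l u ih =>
    obtain ⟨m, ha, hp⟩ := h
    by_cases hl : l = .hash
    · subst hl
      cases ha
      obtain _ | ⟨l, u⟩ := u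
      · exact ⟨[], rfl, by simp, hp.symm⟩
      · obtain ⟨m, ha, -⟩ := hp
        cases ha
    · obtain ⟨u', rfl, h1, h2⟩ := ih hp (by
        rcases List.mem_cons.1 hu with h | h
        · exact absurd h.symm hl
        · exact h)
      refine ⟨l :: u', rfl, ?_, h2⟩
      simpa [hl] using h1

/-- The total duration of a timed word. -/
def dur {Γ : Type} (w : TimedWord Γ) : ℝ≥0 := (w.map Prod.fst).sum

@[simp] theorem dur_nil {Γ : Type} : dur ([] : TimedWord Γ) = 0 := rfl

@[simp] theorem dur_cons {Γ : Type} (e : ℝ≥0 × Letter Γ) (w : TimedWord Γ) :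
    dur (e :: w) = e.1 + dur w := by simp [dur]

@[simp] theorem dur_append {Γ : Type} (w w' : TimedWord Γ) :
    dur (w ++ w') = dur w + dur w' := by simp [dur]

/-- The absolute time of the letter with index `k`. -/
def time {Γ : Type} (w : TimedWord Γ) (k : ℕ) : ℝ≥0 := dur (w.take (k + 1))

theorem time_lt_succ {Γ : Type} {z : ℝ≥0} (hz : z < 1) {w : TimedWord Γ} (h : Timed z w) {k : ℕ}
    (hk : k + 1 < w.length) : time w k < time w (k + 1) := by
  have hpos : ∀ (w : TimedWord Γ) (z : ℝ≥0), z < 1 → Timed z w → ∀ e ∈ w, 0 < e.1 := by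
    intro w
    induction w with
    | nil => simp
    | cons e w ih =>
      obtain ⟨d, l⟩ := e
      intro z hz h
      by_cases hl : l.IsMark
      · rw [timed_cons_mark hl] at h
        have hd : 0 < d := by
          rw [pos_iff_ne_zero]; rintro rfl; rw [add_zero] at h; exact hz.ne h.1
        simpa [hd] using ih 0 one_pos h.2
      · obtain _ | _ | c := l
        · exact absurd trivial hl
        · exact absurd trivial hl
        obtain ⟨h3, h4, h5⟩ := h
        simpa [h4] using ih _ h3 h5
  have h1 := hpos w z hz h w[k + 1] (List.getElem_mem hk)
  rw [time, time, List.take_add_one (i := k + 1), dur_append, List.getElem?_eq_getElem hk]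
  simpa using h1

/-- The marks are exactly the letters at integer times. -/
theorem mark_iff_time {Γ : Type} {z : ℝ≥0} (hz : z < 1) {w : TimedWord Γ} (h : Timed z w) {k : ℕ}
    {d : ℝ≥0} {l : Letter Γ} (hk : w[k]? = some (d, l)) :
    l.IsMark ↔ ∃ m : ℕ, z + time w k = m := by
  induction w generalizing z k with
  | nil => simp at hk
  | cons e w ih =>
    obtain ⟨d', l'⟩ := e
    obtain _ | k := k
    · simp only [List.getElem?_cons_zero, Option.some.injEq, Prod.mk.injEq] at hk
      obtain ⟨rfl, rfl⟩ := hk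
      by_cases hl : l'.IsMark
      · rw [timed_cons_mark hl] at h
        simp only [hl, true_iff]
        exact ⟨1, by simpa [time] using h.1⟩
      · obtain _ | _ | c := l'
        · exact absurd trivial hl
        · exact absurd trivial hl
        obtain ⟨h3, h4, h5⟩ := h
        simp only [hl, false_iff, not_exists]
        intro m hm
        simp only [time, zero_add, List.take_succ_cons, List.take_zero, dur_cons, dur_nil,
          add_zero] at hm
        have h6 : 0 < z + d' := by positivity
        rw [hm] at h3 h6
        norm_cast at h3 h6
        omega
    · rw [List.getElem?_cons_succ] at hk
      have ht : time ((d', l') :: w) (k + 1) = d' + time w k := by simp [time]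
      by_cases hl : l'.IsMark
      · rw [timed_cons_mark hl] at h
        rw [ih one_pos h.2 hk, ht, ← add_assoc, h.1, zero_add]
        constructor
        · rintro ⟨m, hm⟩
          exact ⟨m + 1, by rw [hm]; push_cast; ring⟩
        · rintro ⟨m, hm⟩
          obtain _ | m := m
          · simp at hm
          · refine ⟨m, ?_⟩
            push_cast at hm
            rw [add_comm (m : ℝ≥0)] at hm
            exact add_left_cancel hm
      · obtain _ | _ | c := l'
        · exact absurd trivial hl
        · exact absurd trivial hl
        obtain ⟨h3, h4, h5⟩ := h
        rw [ih h3 h5 hk, ht, add_assoc]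

/-! ### The words in which an error is found -/

/-- No letter is `hash`. -/
def HashFree {Γ : Type} (w : TimedWord Γ) : Prop := ∀ e ∈ w, e.2 ≠ .hash

theorem reads_watch_of_hashFree {v : Val} {w : TimedWord Γ} (h : HashFree w) :
    Reads M a b c n .watch v w := by
  induction w generalizing v with
  | nil => trivial
  | cons e w ih =>
    exact ⟨_, _, _, .watch (h e (by simp)), by simp, ih fun e he => h e (by simp [he])⟩

theorem reads_watch_append {w w' : TimedWord Γ} (h : HashFree w)
    (h' : ∀ v, Reads M a b c n .watch v w') (v : Val) :
    Reads M a b c n .watch v (w ++ w') := by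
  induction w generalizing v with
  | nil => exact h' v
  | cons e w ih =>
    exact ⟨_, _, _, .watch (h e (by simp)), by simp, ih (fun e he => h e (by simp [he])) _⟩

theorem reads_ok {v : Val} {w : TimedWord Γ} : Reads M a b c n .ok v w := by
  induction w generalizing v with
  | nil => trivial
  | cons e w ih => exact ⟨_, _, _, .ok, by simp, ih⟩

theorem reads_late {v : Val} {l l' : Letter Γ} {w w' : TimedWord Γ} {d : ℝ≥0} (h : HashFree w)
    (hlt : v 0 + dur w < 1)
    (herr : v 0 + dur w + d = 1 ∧ Mismatch l l' ∨ 1 < v 0 + dur w + d) :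
    Reads M a b c n (.late l) v (w ++ (d, l') :: w') := by
  induction w generalizing v with
  | nil =>
    simp only [dur_nil, add_zero] at herr
    rcases herr with ⟨h1, h2⟩ | h1
    · exact ⟨_, _, _, .wrong h2, by simpa [Atom.holds, Cmp.holds, Val.delay] using h1, reads_ok⟩
    · exact ⟨_, _, _, .missing, by simpa [Atom.holds, Cmp.holds, Val.delay] using h1, reads_ok⟩
  | cons e w ih =>
    have h0 : ((v.delay e.1).reset []) 0 + dur w = v 0 + dur (e :: w) := by
      simp [Val.reset, Val.delay, add_assoc]
    refine ⟨_, _, _, .wait (h e (by simp)), ?_, ih (fun e he => h e (by simp [he])) ?_ ?_⟩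
    · simp only [List.mem_cons, List.not_mem_nil, or_false, forall_eq, Atom.holds, Cmp.holds,
        Val.delay, Nat.cast_one]
      refine lt_of_le_of_lt ?_ hlt
      rw [dur_cons, ← add_assoc]
      exact le_self_add
    · rwa [h0]
    · rwa [h0]

theorem reads_between {v : Val} {l' : Letter Γ} {w w' : TimedWord Γ} {d : ℝ≥0} (h : HashFree w)
    (h0 : 1 < v 0 + dur w + d) (h1 : v 1 + dur w + d < 1) :
    Reads M a b c n .between v (w ++ (d, l') :: w') := by
  induction w generalizing v with
  | nil =>
    simp only [dur_nil, add_zero] at h0 h1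
    refine ⟨_, _, _, .extra, ?_, reads_ok⟩
    simp only [List.mem_cons, List.not_mem_nil, or_false, forall_eq_or_imp, forall_eq,
      Atom.holds, Cmp.holds, Val.delay, Nat.cast_one]
    exact ⟨h0, h1⟩
  | cons e w ih =>
    refine ⟨_, _, _, .waitGap (h e (by simp)), by simp,
      ih (fun e he => h e (by simp [he])) ?_ ?_⟩
    · simpa [Val.reset, Val.delay, add_assoc] using h0
    · simpa [Val.reset, Val.delay, add_assoc] using h1

theorem exists_split {α : Type} {w : List α} {i k : ℕ} {e e' : α} (hik : i < k)
    (hi : w[i]? = some e) (hk : w[k]? = some e') :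
    ∃ w₁ w₂ w₃, w = w₁ ++ e :: (w₂ ++ e' :: w₃) ∧ w₁.length = i ∧
      w₂.length = k - (i + 1) := by
  obtain ⟨hi', rfl⟩ := List.getElem?_eq_some_iff.1 hi
  obtain ⟨hk', rfl⟩ := List.getElem?_eq_some_iff.1 hk
  refine ⟨w.take i, (w.drop (i + 1)).take (k - (i + 1)), w.drop (k + 1), ?_, ?_, ?_⟩
  · conv_lhs => rw [← List.take_append_drop i w, List.drop_eq_getElem_cons hi',
      ← List.take_append_drop (k - (i + 1)) (w.drop (i + 1)), List.drop_drop,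
      show i + 1 + (k - (i + 1)) = k by omega, List.drop_eq_getElem_cons hk']
  · simp; omega
  · simp; omega

theorem take_eq {α : Type} (w₁ w₂ : List α) {k : ℕ} (h : w₁.length = k) :
    (w₁ ++ w₂).take k = w₁ := by
  subst h; simp

/-- The error detector notices a letter that is followed one time unit later by a wrong letter or by
no letter at all. -/
theorem reads_watch_of_late {w : TimedWord Γ} {i k : ℕ} {e e' : ℝ≥0 × Letter Γ}
    (hik : i < k) (hi : w[i]? = some e) (hk : w[k]? = some e') (hfree : HashFree (w.take k))
    (hlt : time w (k - 1) < time w i + 1)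
    (herr : time w k = time w i + 1 ∧ Mismatch e.2 e'.2 ∨ time w i + 1 < time w k) (v : Val) :
    Reads M a b c n .watch v w := by
  obtain ⟨w₁, w₂, w₃, rfl, h1, h2⟩ := exists_split hik hi hk
  have hi : time (w₁ ++ e :: (w₂ ++ e' :: w₃)) i = dur w₁ + e.1 := by
    rw [time, show w₁ ++ e :: (w₂ ++ e' :: w₃) = (w₁ ++ [e]) ++ (w₂ ++ e' :: w₃) by simp,
      take_eq _ _ (by simp [h1])]
    simp
  have hk' : (w₁ ++ e :: (w₂ ++ e' :: w₃)).take k = w₁ ++ e :: w₂ := by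
    rw [show w₁ ++ e :: (w₂ ++ e' :: w₃) = (w₁ ++ e :: w₂) ++ (e' :: w₃) by simp,
      take_eq _ _ (by simp [h1, h2]; omega)]
  have hk1 : time (w₁ ++ e :: (w₂ ++ e' :: w₃)) (k - 1) = dur w₁ + e.1 + dur w₂ := by
    rw [time, Nat.sub_add_cancel (by omega), hk']
    simp [add_assoc]
  have hk2 : time (w₁ ++ e :: (w₂ ++ e' :: w₃)) k = dur w₁ + e.1 + (dur w₂ + e'.1) := by
    rw [time, show w₁ ++ e :: (w₂ ++ e' :: w₃) = (w₁ ++ e :: (w₂ ++ [e'])) ++ w₃ by simp,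
      take_eq _ _ (by simp [h1, h2]; omega)]
    simp [add_assoc]
  rw [hk'] at hfree
  rw [hi, hk1, add_lt_add_iff_left] at hlt
  rw [hi, hk2, add_right_inj, add_lt_add_iff_left] at herr
  refine reads_watch_append (fun x hx => hfree x (by simp [hx])) (fun v => ?_) v
  refine ⟨_, _, _, .guess (hfree e (by simp)), by simp, ?_⟩
  refine reads_late (fun x hx => hfree x (by simp [hx])) ?_ ?_
  · simpa [Val.reset] using hlt
  · simpa [Val.reset] using herr

/-- The error detector notices a letter strictly between the times at which the counterparts of two
consecutive letters are due. -/
theorem reads_watch_of_gap {w : TimedWord Γ} {i k : ℕ}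
    (hik : i + 1 < k) (hk : k < w.length) (hfree : HashFree (w.take k))
    (hlt : time w i + 1 < time w k) (hgt : time w k < time w (i + 1) + 1) (v : Val) :
    Reads M a b c n .watch v w := by
  obtain ⟨w₁, w₂, w₃, hw, h1, h2⟩ := exists_split hik
    (List.getElem?_eq_getElem (by omega)) (List.getElem?_eq_getElem hk)
  obtain ⟨w₀, e₀, rfl⟩ : ∃ w₀ e₀, w₁ = w₀ ++ [e₀] := by
    refine ⟨w₁.dropLast, w₁.getLast ?_, (List.dropLast_append_getLast _).symm⟩
    rintro rfl; simp at h1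
  generalize w[i + 1]'(by omega) = e at hw
  generalize w[k] = e' at hw
  rw [List.append_assoc, List.singleton_append] at hw
  simp only [List.length_append, List.length_singleton, add_left_inj] at h1
  subst hw
  have hi : time (w₀ ++ e₀ :: (e :: (w₂ ++ e' :: w₃))) i = dur w₀ + e₀.1 := by
    rw [time, show w₀ ++ e₀ :: (e :: (w₂ ++ e' :: w₃)) =
      (w₀ ++ [e₀]) ++ (e :: (w₂ ++ e' :: w₃)) by simp, take_eq _ _ (by simp [h1])]
    simp
  have hi1 : time (w₀ ++ e₀ :: (e :: (w₂ ++ e' :: w₃))) (i + 1) = dur w₀ + e₀.1 + e.1 := by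
    rw [time, show w₀ ++ e₀ :: (e :: (w₂ ++ e' :: w₃)) =
      (w₀ ++ [e₀, e]) ++ (w₂ ++ e' :: w₃) by simp, take_eq _ _ (by simp [h1])]
    simp [add_assoc]
  have hk' : (w₀ ++ e₀ :: (e :: (w₂ ++ e' :: w₃))).take k = w₀ ++ e₀ :: (e :: w₂) := by
    rw [show w₀ ++ e₀ :: (e :: (w₂ ++ e' :: w₃)) = (w₀ ++ e₀ :: (e :: w₂)) ++ (e' :: w₃) by simp,
      take_eq _ _ (by simp [h1, h2]; omega)]
  have hk2 : time (w₀ ++ e₀ :: (e :: (w₂ ++ e' :: w₃))) k =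
      dur w₀ + e₀.1 + (e.1 + dur w₂ + e'.1) := by
    rw [time, show w₀ ++ e₀ :: (e :: (w₂ ++ e' :: w₃)) =
      (w₀ ++ e₀ :: (e :: (w₂ ++ [e']))) ++ w₃ by simp, take_eq _ _ (by simp [h1, h2]; omega)]
    simp [add_assoc]
  rw [hk'] at hfree
  rw [hi, hk2, add_lt_add_iff_left] at hlt
  rw [hi1, hk2, add_assoc e.1, ← add_assoc _ e.1, add_lt_add_iff_left] at hgt
  refine reads_watch_append (fun x hx => hfree x (by simp [hx])) (fun v => ?_) v
  refine ⟨_, _, _, .guessGap (hfree e₀ (by simp)), by simp, ?_⟩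
  refine ⟨_, _, _, .closeGap (hfree e (by simp)), by simp, ?_⟩
  refine reads_between (fun x hx => hfree x (by simp [hx])) ?_ ?_
  · simpa [Val.reset, Val.delay] using hlt
  · simpa [Val.reset] using hgt

/-- A generated word in which the error detector finds nothing is periodic. -/
theorem exists_periodic_of_not_reads {w : TimedWord Γ}
    (hgen : Reads M a b c n (.gen .start) (fun _ => 0) w)
    (hno : ¬ Reads M a b c n .watch (fun _ => 0) w) :
    ∃ p u, 0 < p ∧ Periodic p (u ++ [.hash]) ∧
      Path (Arc M a b c n) .start (u ++ [.hash]) .final := by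
  obtain ⟨htimed, t, hpath⟩ := (reads_gen_iff rfl).1 hgen
  have hhash : .hash ∈ w.map Prod.snd := by
    by_contra h
    exact hno (reads_watch_of_hashFree fun e he h' => h (List.mem_map.2 ⟨e, he, h'⟩))
  obtain ⟨u, hu, hufree, rfl⟩ := hash_last hpath hhash
  have hlen : w.length = u.length + 1 := by simpa using congrArg List.length hu
  have hfree : ∀ k ≤ u.length, HashFree (w.take k) := by
    intro k hk e he
    refine hufree e.2 ?_
    have h1 := List.mem_map_of_mem (f := Prod.snd) he
    rw [List.map_take, hu, List.take_append_of_le_length hk] at h1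
    exact List.mem_of_mem_take h1
  have hmono : ∀ i j, i < j → j < w.length → time w i < time w j := by
    intro i j hij hj
    induction j with
    | zero => omega
    | succ j ih =>
      have h1 := time_lt_succ zero_lt_one htimed hj
      rcases Nat.lt_succ_iff_lt_or_eq.1 hij with h | rfl
      · exact (ih h (by omega)).trans h1
      · exact h1
  have hmark : ∀ i l, (u ++ [.hash])[i]? = some l →
      (l.IsMark ↔ ∃ m : ℕ, time w i = m) := by
    intro i l hl
    rw [← hu, List.getElem?_map, Option.map_eq_some_iff] at hl
    obtain ⟨⟨d, l⟩, h1, rfl⟩ := hl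
    simpa using mark_iff_time zero_lt_one htimed h1
  have htime0 : time w 0 = 1 ∧ u ≠ [] := by
    obtain _ | ⟨⟨d, l⟩, w⟩ := w
    · simp at hlen
    obtain ⟨m, ha, -⟩ := hpath
    cases ha
    refine ⟨?_, by rintro rfl; simp at hu⟩
    have := htimed.1
    simpa [time] using this
  obtain ⟨h0, hne⟩ := htime0
  have hupos := List.length_pos_iff.2 hne
  have hlast : 2 ≤ time w u.length := by
    obtain ⟨m, hm⟩ := (hmark u.length .hash (by simp)).1 trivial
    have h1 := hmono 0 u.length hupos (by omega)
    rw [h0, hm] at h1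
    rw [hm]
    norm_cast at h1 ⊢
  have hex : ∃ k, 2 ≤ time w k := ⟨_, hlast⟩
  -- the period is the index of the first letter that comes one time unit after the first letter
  obtain ⟨p, hp2, hpmin⟩ : ∃ p, 2 ≤ time w p ∧ ∀ k < p, time w k < 2 := by
    classical
    exact ⟨Nat.find hex, Nat.find_spec hex, fun k hk => not_le.1 (Nat.find_min hex hk)⟩
  have hple : p ≤ u.length := by
    by_contra h
    exact absurd hlast (not_le.2 (hpmin _ (by omega)))
  have hppos : 0 < p := by
    rw [Nat.pos_iff_ne_zero]
    rintro rfl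
    rw [h0] at hp2
    norm_num at hp2
  have htwo : time w 0 + 1 = 2 := by rw [h0]; norm_num
  have hget : ∀ i, ∀ hi : i < w.length, w[i]? = some w[i] := fun i hi =>
    List.getElem?_eq_getElem hi
  have hlate : ∀ i k, i < k → k ≤ u.length → time w (k - 1) < time w i + 1 →
      time w k ≤ time w i + 1 := by
    intro i k hik hk h1
    by_contra h2
    exact hno (reads_watch_of_late hik (hget i (by omega)) (hget k (by omega)) (hfree k hk) h1
      (.inr (not_le.1 h2)) _)
  have hshift : ∀ i, i + p ≤ u.length → time w (i + p) = time w i + 1 := by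
    intro i
    -- inserted letters are excluded by `reads_watch_of_gap`, omitted ones by `hlate`
    induction i with
    | zero =>
      intro _
      rw [zero_add]
      refine le_antisymm (hlate 0 p hppos hple ?_) (by rwa [htwo])
      rw [htwo]
      exact hpmin _ (by omega)
    | succ i ih =>
      intro hi
      have h1 := ih (by omega)
      refine le_antisymm (hlate (i + 1) _ (by omega) hi ?_) ?_
      · rw [show i + 1 + p - 1 = i + p by omega, h1, add_lt_add_iff_right]
        exact hmono _ _ (by omega) (by omega)
      · by_contra h2
        refine hno (reads_watch_of_gap (i := i) (k := i + 1 + p) (by omega) (by omega)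
          (hfree _ hi) ?_ (not_le.1 h2) _)
        rw [← h1]
        exact hmono _ _ (by omega) (by omega)
  refine ⟨p, u, hppos, ⟨fun i l hl => ?_, fun i d d' hd hd' => ?_⟩, hu ▸ hpath⟩
  · rw [hmark i l hl]
    have hi : i ≤ u.length := by
      have := (List.getElem?_eq_some_iff.1 hl).1
      simp at this; omega
    clear hl
    induction i using Nat.strong_induction_on with
    | _ i ih =>
      rcases lt_or_ge i p with hip | hip
      · obtain _ | i := i
        · simp only [dvd_zero, iff_true]
          exact ⟨1, by rw [h0, Nat.cast_one]⟩
        · have h1 := hmono 0 (i + 1) (by omega) (by omega)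
          have h2 := hpmin (i + 1) hip
          refine ⟨fun ⟨m, hm⟩ => ?_, fun h =>
            absurd (Nat.le_of_dvd (by omega) h) (by omega)⟩
          rw [hm] at h1 h2
          rw [h0] at h1
          norm_cast at h1 h2
          omega
      · obtain ⟨j, rfl⟩ := Nat.exists_eq_add_of_le' hip
        have hj := ih j (by omega) (by omega)
        refine Iff.trans ?_ (hj.trans Nat.dvd_add_self_right.symm)
        rw [hshift j hi]
        constructor
        · rintro ⟨m, hm⟩
          obtain _ | m := m
          · simp at hm
          · exact ⟨m, add_right_cancel (hm.trans (Nat.cast_succ m))⟩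
        · rintro ⟨m, hm⟩
          exact ⟨m + 1, by rw [hm, Nat.cast_succ]⟩
  · by_contra hne
    have hi : i + p ≤ u.length := by
      have := (List.getElem?_eq_some_iff.1 hd').1
      simp at this; omega
    rw [← hu, List.getElem?_map, Option.map_eq_some_iff] at hd hd'
    obtain ⟨e, he, hee⟩ := hd
    obtain ⟨e', he', hee'⟩ := hd'
    refine hno (reads_watch_of_late (by omega) he he' (hfree _ hi) ?_
      (.inl ⟨hshift i hi, d, d', hee, hee', hne⟩) _)
    rw [← hshift i hi]
    exact hmono _ _ (by omega) (by omega)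

/-! ### Periodic words are generated and contain no error -/

theorem reads_late_imp {v : Val} {l : Letter Γ} {w : TimedWord Γ} (hv : v 0 < 1)
    (h : Reads M a b c n (.late l) v w) :
    HashFree w ∨ ∃ w₁ d l' w₂, w = w₁ ++ (d, l') :: w₂ ∧ v 0 + dur w₁ < 1 ∧
      (v 0 + dur w₁ + d = 1 ∧ Mismatch l l' ∨ 1 < v 0 + dur w₁ + d) := by
  induction w generalizing v with
  | nil => exact .inl (by simp [HashFree])
  | cons e w ih =>
    obtain ⟨d, l'⟩ := e
    obtain ⟨g, R, y, ht, hg, hr⟩ := h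
    cases ht with
    | wait hl =>
      simp only [List.mem_cons, List.not_mem_nil, or_false, forall_eq, Atom.holds, Cmp.holds,
        Val.delay, Nat.cast_one] at hg
      rcases ih (v := (v.delay d).reset []) (by simpa [Val.reset, Val.delay] using hg) hr with
        h | ⟨w₁, d', l', w₂, rfl, h1, h2⟩
      · exact .inl (by simpa [HashFree, hl] using h)
      · refine .inr ⟨(d, _) :: w₁, d', l', w₂, rfl, ?_, ?_⟩
        · simpa [Val.reset, Val.delay, add_assoc] using h1
        · simpa [Val.reset, Val.delay, add_assoc] using h2
    | wrong hl =>
      refine .inr ⟨[], d, l', w, rfl, by simpa using hv, .inl ⟨?_, hl⟩⟩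
      simpa [Atom.holds, Cmp.holds, Val.delay] using hg
    | missing =>
      refine .inr ⟨[], d, l', w, rfl, by simpa using hv, .inr ?_⟩
      simpa [Atom.holds, Cmp.holds, Val.delay] using hg

theorem reads_between_imp {v : Val} {w : TimedWord Γ} (h : Reads M a b c n .between v w) :
    HashFree w ∨ ∃ w₁ e w₂, w = w₁ ++ e :: w₂ ∧
      1 < v 0 + dur w₁ + e.1 ∧ v 1 + dur w₁ + e.1 < 1 := by
  induction w generalizing v with
  | nil => exact .inl (by simp [HashFree])
  | cons e w ih =>
    obtain ⟨d, l'⟩ := e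
    obtain ⟨g, R, y, ht, hg, hr⟩ := h
    cases ht with
    | waitGap hl =>
      rcases ih hr with h | ⟨w₁, e, w₂, rfl, h1, h2⟩
      · exact .inl (by simpa [HashFree, hl] using h)
      · refine .inr ⟨(d, _) :: w₁, e, w₂, rfl, ?_, ?_⟩
        · simpa [Val.reset, Val.delay, add_assoc] using h1
        · simpa [Val.reset, Val.delay, add_assoc] using h2
    | extra =>
      simp only [List.mem_cons, List.not_mem_nil, or_false, forall_eq_or_imp, forall_eq,
        Atom.holds, Cmp.holds, Val.delay, Nat.cast_one] at hg
      exact .inr ⟨[], (d, l'), w, rfl, by simpa using hg.1, by simpa using hg.2⟩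

/-- If the error detector can read a word with `hash`, then the word contains a wrong or missing
counterpart of some letter, or a letter without a counterpart one time unit before. -/
theorem reads_watch_imp {v : Val} {w : TimedWord Γ} (h : Reads M a b c n .watch v w) :
    HashFree w ∨
    (∃ w₀ e w₁ e' w₂, w = w₀ ++ e :: (w₁ ++ e' :: w₂) ∧ dur w₁ < 1 ∧
      (dur w₁ + e'.1 = 1 ∧ Mismatch e.2 e'.2 ∨ 1 < dur w₁ + e'.1)) ∨
    (∃ w₀ e e₁ w₁ e' w₂, w = w₀ ++ e :: (e₁ :: (w₁ ++ e' :: w₂)) ∧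
      1 < e₁.1 + dur w₁ + e'.1 ∧ dur w₁ + e'.1 < 1) := by
  induction w generalizing v with
  | nil => exact .inl (by simp [HashFree])
  | cons e w ih =>
    obtain ⟨d, l⟩ := e
    obtain ⟨g, R, y, ht, hg, hr⟩ := h
    cases ht with
    | watch hl =>
      rcases ih hr with h | ⟨w₀, e, w₁, e', w₂, rfl, h⟩ | ⟨w₀, e, e₁, w₁, e', w₂, rfl, h⟩
      · exact .inl (by simpa [HashFree, hl] using h)
      · exact .inr (.inl ⟨(d, l) :: w₀, e, w₁, e', w₂, rfl, h⟩)
      · exact .inr (.inr ⟨(d, l) :: w₀, e, e₁, w₁, e', w₂, rfl, h⟩)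
    | guess hl =>
      rcases reads_late_imp (by simp [Val.reset]) hr with h | ⟨w₁, d', l', w₂, rfl, h1, h2⟩
      · exact .inl (by simpa [HashFree, hl] using h)
      · refine .inr (.inl ⟨[], (d, l), w₁, (d', l'), w₂, rfl, ?_, ?_⟩)
        · simpa [Val.reset] using h1
        · simpa [Val.reset] using h2
    | guessGap hl =>
      obtain _ | ⟨⟨d₁, l₁⟩, w⟩ := w
      · exact .inl (by simpa [HashFree] using hl)
      obtain ⟨g, R, y, ht, hg, hr⟩ := hr
      cases ht with
      | closeGap hl₁ =>
        rcases reads_between_imp hr with h | ⟨w₁, e', w₂, rfl, h1, h2⟩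
        · exact .inl (by simpa [HashFree, hl, hl₁] using h)
        · refine .inr (.inr ⟨[], (d, l), (d₁, l₁), w₁, e', w₂, rfl, ?_, ?_⟩)
          · simpa [Val.reset, Val.delay] using h1
          · simpa [Val.reset] using h2

theorem timed_uniform {Γ : Type} {p : ℕ} (hp : 0 < p) {u : List (Letter Γ)} {j : ℕ} (hj : j < p)
    (h : ∀ i l, u[i]? = some l → (l.IsMark ↔ p ∣ j + 1 + i)) :
    Timed ((j : ℝ≥0) / p) (u.map fun l => (1 / (p : ℝ≥0), l)) := by
  have hp' : (p : ℝ≥0) ≠ 0 := by positivity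
  induction u generalizing j with
  | nil => trivial
  | cons l u ih =>
    have hsum : (j : ℝ≥0) / p + 1 / p = ((j + 1 : ℕ) : ℝ≥0) / p := by push_cast; ring
    have h0 := h 0 l rfl
    have htail : ∀ i l, u[i]? = some l → (l.IsMark ↔ p ∣ j + 1 + (i + 1)) :=
      fun i l' hl' => h (i + 1) l' (by simpa using hl')
    by_cases hl : l.IsMark
    · have hj1 : j + 1 = p := by
        have := Nat.le_of_dvd (by omega) (h0.1 hl)
        omega
      rw [List.map_cons, timed_cons_mark hl, hsum, hj1]
      refine ⟨div_self hp', ?_⟩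
      have := ih (j := 0) hp fun i l' hl' => by
        rw [htail i l' hl', hj1, Nat.dvd_add_right dvd_rfl]
        ring_nf
      simpa using this
    · obtain _ | _ | c := l
      · exact absurd trivial hl
      · exact absurd trivial hl
      have hj1 : j + 1 < p := by
        rcases lt_or_eq_of_le (Nat.succ_le_of_lt hj) with h1 | h1
        · exact h1
        · exact absurd (h0.2 (by rw [add_zero, show j + 1 = p from h1])) hl
      refine ⟨?_, by positivity, ?_⟩
      · rw [hsum, div_lt_one (by positivity)]
        exact_mod_cast hj1
      · rw [hsum]
        refine ih hj1 fun i l' hl' => ?_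
        rw [htail i l' hl']
        ring_nf

/-- The timed word in which the first letter comes at time `1` and all further delays are `1 / p`. -/
noncomputable def uniform {Γ : Type} (p : ℕ) : List (Letter Γ) → TimedWord Γ
  | [] => []
  | l :: u => (1, l) :: u.map fun l => (1 / (p : ℝ≥0), l)

theorem map_snd_uniform {Γ : Type} (p : ℕ) (u : List (Letter Γ)) :
    (uniform p u).map Prod.snd = u := by
  cases u <;> simp [uniform, Function.comp_def]

theorem delay_of_uniform {Γ : Type} {p : ℕ} {u : List (Letter Γ)} {w₀ w : TimedWord Γ}
    {e : ℝ≥0 × Letter Γ} (h : uniform p u = w₀ ++ e :: w) : ∀ e' ∈ w, e'.1 = 1 / (p : ℝ≥0) := by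
  have key : ∀ e' ∈ (uniform p u).tail, e'.1 = 1 / (p : ℝ≥0) := by
    cases u <;> simp [uniform]
  intro e' he'
  apply key
  rw [h]
  cases w₀ <;> simp [he']

theorem dur_of_delay {Γ : Type} {δ : ℝ≥0} {w : TimedWord Γ} (h : ∀ e ∈ w, e.1 = δ) :
    dur w = w.length * δ := by
  induction w with
  | nil => simp
  | cons e w ih =>
    rw [dur_cons, ih fun e he => h e (by simp [he]), h e (by simp)]
    push_cast [List.length_cons]; ring

/-- A periodic word is generated with all delays equal to `1 / p` after the first letter, and then no
error can be found: one time unit is exactly `p` letters. -/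
theorem exists_not_reads_of_periodic {p : ℕ} {u : List (Letter Γ)} (hp : 0 < p)
    (hper : Periodic p (u ++ [.hash]))
    (hpath : Path (Arc M a b c n) .start (u ++ [.hash]) .final) :
    ∃ w, Reads M a b c n (.gen .start) (fun _ => 0) w ∧
      ¬ Reads M a b c n .watch (fun _ => 0) w := by
  have hp' : (0 : ℝ≥0) < p := by exact_mod_cast hp
  refine ⟨uniform p (u ++ [.hash]), (reads_gen_iff rfl).2 ⟨?_, .final, ?_⟩, fun h => ?_⟩
  · obtain ⟨l, u', hu⟩ : ∃ l u', u ++ [.hash] = l :: u' := by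
      cases u <;> simp
    rw [hu] at hper ⊢
    have hl : l.IsMark := (hper.mark 0 l rfl).2 (dvd_zero p)
    rw [uniform, timed_cons_mark hl]
    refine ⟨by simp, ?_⟩
    have := timed_uniform hp (u := u') hp fun i l' hl' => by
      rw [hper.mark (i + 1) l' (by simpa using hl')]
      ring_nf
    simpa using this
  · rwa [map_snd_uniform]
  · rcases reads_watch_imp h with h | ⟨w₀, e, w₁, e', w₂, hw, h1, h2⟩ |
      ⟨w₀, e, e₁, w₁, e', w₂, hw, h1, h2⟩
    · have h1 : .hash ∈ (uniform p (u ++ [.hash])).map Prod.snd := by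
        rw [map_snd_uniform]; simp
      obtain ⟨e, he, h2⟩ := List.mem_map.1 h1
      exact h e he h2
    · have hd := delay_of_uniform hw
      have h3 : dur w₁ = w₁.length * (1 / p) := dur_of_delay fun e he => hd e (by simp [he])
      have h4 : dur w₁ + e'.1 = ((w₁.length + 1 : ℕ) : ℝ≥0) / p := by
        rw [h3, hd e' (by simp)]; push_cast; ring
      rw [h3, mul_one_div, div_lt_one hp', Nat.cast_lt] at h1
      rw [h4, div_eq_one_iff_eq hp'.ne', one_lt_div hp', Nat.cast_inj, Nat.cast_lt] at h2
      rcases h2 with ⟨h5, d, d', h6, h7, h8⟩ | h5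
      · have hu := congrArg (List.map Prod.snd) hw
        rw [map_snd_uniform] at hu
        refine h8 (hper.copy w₀.length d d' ?_ ?_)
        · rw [hu]; simp [h6]
        · rw [hu, ← h5]
          simp [h7]
      · omega
    · have hd := delay_of_uniform hw
      have h3 : dur w₁ = w₁.length * (1 / p) := dur_of_delay fun e he => hd e (by simp [he])
      have h4 : dur w₁ + e'.1 = ((w₁.length + 1 : ℕ) : ℝ≥0) / p := by
        rw [h3, hd e' (by simp)]; push_cast; ring
      have h5 : e₁.1 + dur w₁ + e'.1 = ((w₁.length + 2 : ℕ) : ℝ≥0) / p := by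
        rw [add_assoc, h4, hd e₁ (by simp)]; push_cast; ring
      rw [h5, one_lt_div hp', Nat.cast_lt] at h1
      rw [h4, div_lt_one hp', Nat.cast_lt] at h2
      omega

/-- Every generated word contains an error if and only if the machine does not halt. -/
theorem reads_gen_subset_iff :
    (∀ w, Reads M a b c n (.gen .start) (fun _ => 0) w → Reads M a b c n .watch (fun _ => 0) w) ↔
      ¬ (StateTransition.eval (TM0.step M) (TM0.init (a :: b :: List.replicate n c))).Dom := by
  rw [eval_dom_iff_exists_periodic]
  constructor
  · rintro h ⟨p, u, hp, hper, hpath⟩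
    obtain ⟨w, h1, h2⟩ := exists_not_reads_of_periodic hp hper hpath
    exact h2 (h w h1)
  · intro h w hw
    by_contra h'
    exact h (exists_periodic_of_not_reads hw h')

end Core

/-! ### Control without controllable actions -/

theorem TTS.reaches_iff_path {S : TTS} {ls : List Label} {s : S.State} :
    S.Reaches ls s ↔ Path S.trans S.start ls s := by
  constructor
  · intro h
    induction h with
    | nil => rfl
    | snoc _ ht ih => exact ih.append ⟨_, ht, rfl⟩
  · induction ls using List.reverseRecOn generalizing s with
    | nil => rintro rfl; exact .nil
    | append_singleton ls l ih =>
      intro h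
      obtain ⟨m, h1, m', h2, rfl⟩ := path_append_iff.1 h
      exact .snoc (ih h1) h2

/-- `f` is a functional bisimulation from the part of `S` that satisfies `P` to `T`. -/
structure TTS.IsCover (S T : TTS) (P : S.State → Prop) (f : S.State → T.State) : Prop where
  start : P S.start ∧ f S.start = T.start
  forth : ∀ s l s', P s → S.trans s l s' → P s' ∧ T.trans (f s) l (f s')
  back : ∀ s l t, P s → T.trans (f s) l t → ∃ s', S.trans s l s' ∧ f s' = t

theorem TTS.IsCover.restrict {S T : TTS} {P : S.State → Prop} {f : S.State → T.State}
    (h : S.IsCover T P f) (L : List ℕ) : (S.restrict L).IsCover (T.restrict L) P f where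
  start := h.start
  forth s l s' hs ht := ⟨(h.forth s l s' hs ht.1).1, (h.forth s l s' hs ht.1).2, ht.2⟩
  back s l t hs ht := by
    obtain ⟨s', h1, h2⟩ := h.back s l t hs ht.1
    exact ⟨s', ⟨h1, ht.2⟩, h2⟩

theorem TTS.IsCover.hide {S T : TTS} {P : S.State → Prop} {f : S.State → T.State}
    (h : S.IsCover T P f) (L : List ℕ) : (S.hide L).IsCover (T.hide L) P f where
  start := h.start
  forth s l s' hs := by
    rintro ⟨l', ht, hl⟩
    exact ⟨(h.forth s l' s' hs ht).1, l', (h.forth s l' s' hs ht).2, hl⟩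
  back s l t hs := by
    rintro ⟨l', ht, hl⟩
    obtain ⟨s', h1, h2⟩ := h.back s l' t hs ht
    exact ⟨s', ⟨l', h1, hl⟩, h2⟩

theorem TTS.IsCover.language_eq {S T : TTS} {P : S.State → Prop} {f : S.State → T.State}
    (h : S.IsCover T P f) : S.language = T.language := by
  have hforth : ∀ ls s, S.Reaches ls s → P s ∧ T.Reaches ls (f s) := by
    intro ls s hs
    induction hs with
    | nil => exact ⟨h.start.1, h.start.2 ▸ .nil⟩
    | snoc _ ht ih => exact ⟨(h.forth _ _ _ ih.1 ht).1, ih.2.snoc (h.forth _ _ _ ih.1 ht).2⟩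
  have hback : ∀ ls t, T.Reaches ls t → ∃ s, S.Reaches ls s ∧ f s = t := by
    intro ls t ht
    induction ht with
    | nil => exact ⟨_, .nil, h.start.2⟩
    | snoc _ ht ih =>
      obtain ⟨s, hs, rfl⟩ := ih
      obtain ⟨s', h1, h2⟩ := h.back _ _ _ (hforth _ _ hs).1 ht
      exact ⟨s', hs.snoc h1, h2⟩
  ext w
  constructor
  · rintro ⟨ls, s, hs, rfl⟩
    exact ⟨ls, f s, (hforth ls s hs).2, rfl⟩
  · rintro ⟨ls, t, ht, rfl⟩
    obtain ⟨s, hs, -⟩ := hback ls t ht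
    exact ⟨ls, s, hs, rfl⟩

theorem TTS.IsCover.isSNNI_iff {S T : TTS} {P : S.State → Prop} {f : S.State → T.State}
    (h : S.IsCover T P f) (L : List ℕ) : S.IsSNNI L ↔ T.IsSNNI L := by
  rw [TTS.IsSNNI, TTS.IsSNNI, (h.restrict L).language_eq, (h.hide L).language_eq]

/-- Without controllable actions, a controller has to let time pass wherever time can pass, so that
the controlled system has the behaviour of the uncontrolled one. -/
theorem isCover_controlled {A : TimedAutomaton} {C : Controller} (hC : IsController A [] C) :
    (controlled A [] C).IsCover A.semantics A.IsRun A.last where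
  start := ⟨trivial, rfl⟩
  forth ρ l ρ' hρ := by
    rintro ⟨s', rfl, hs, -⟩
    exact ⟨⟨hρ, hs⟩, hs⟩
  back ρ l t hρ ht := by
    refine ⟨(l, t) :: ρ, ⟨t, rfl, ht, ?_⟩, rfl⟩
    rcases l with (_ | a) | d
    · trivial
    · exact .inl (by simp)
    · intro d' h0 hd'
      have hinv := ht.2.2
      refine ⟨((A.last ρ).1, (A.last ρ).2.delay d'),
        ⟨rfl, rfl, fun e he he' => hinv e he (he'.trans hd'.le)⟩, ?_⟩
      set s' : AState := ((A.last ρ).1, (A.last ρ).2.delay d')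
      have hrun : A.IsRun ((.delay d', s') :: ρ) :=
        ⟨hρ, rfl, rfl, fun e he he' => hinv e he (he'.trans hd'.le)⟩
      have hwait : A.CanWait s' := by
        refine ⟨d - d', tsub_pos_of_lt hd', (s'.1, s'.2.delay (d - d')), rfl, rfl,
          fun e he he' => ?_⟩
        have h1 : s'.2.delay e = (A.last ρ).2.delay (d' + e) := by
          funext x
          simp [s', Val.delay, add_assoc]
        rw [h1]
        refine hinv _ (zero_le) ?_
        calc d' + e ≤ d' + (d - d') := by gcongr
          _ = d := add_tsub_cancel_of_le hd'.le
      obtain ⟨c, hc⟩ := hC.nonblocking _ hrun hwait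
      cases c with
      | wait => exact hc
      | enable a => exact absurd (hC.enable_possible _ a hrun hc).1 (by simp)

theorem snniControl_iff_of_ctrl_nil (A : TimedAutomaton) (high : List ℕ) :
    SNNIControl ⟨A, high, []⟩ ↔ A.semantics.IsSNNI high := by
  constructor
  · rintro ⟨C, hC, h⟩
    exact ((isCover_controlled hC).isSNNI_iff high).1 h
  · intro h
    let C : Controller := fun ρ => {c | c = .wait ∧ A.CanWait (A.last ρ)}
    have hC : IsController A [] C :=
      ⟨fun ρ a _ ha => by simp [C] at ha, fun ρ _ h => h.2, fun ρ _ h => ⟨.wait, rfl, h⟩⟩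
    exact ⟨C, hC, ((isCover_controlled hC).isSNNI_iff high).2 h⟩

/-! ### The languages of the timed automaton -/

section Semantics

variable {Γ Λ : Type} [Inhabited Γ] [Inhabited Λ]

/-- The label of an edge, for a numbering of the letters; the high-level action is `0`. -/
def Lab.code (eL : Letter Γ → ℕ) : Lab Γ → Option ℕ
  | .eps => none
  | .high => some 0
  | .low l => some (eL l + 1)

/-- The edges and locations of `A` are those of `Trans`, up to an injective numbering of the
locations and letters, and `A` has no invariants. -/
structure Realizes (M : TM0.Machine Γ Λ) (a b c : Γ) (n : ℕ) (eX : Loc Γ Λ → ℕ)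
    (eL : Letter Γ → ℕ) (A : TimedAutomaton) : Prop where
  injLoc : Function.Injective eX
  injLetter : Function.Injective eL
  start : A.start = eX .init
  inv : A.inv = []
  mem_edges : ∀ e, e ∈ A.edges ↔ ∃ x g l R y, Trans M a b c n x g l R y ∧
    e = ⟨eX x, g, l.code eL, R, eX y⟩

/-- The numbering of the letters of a timed word. -/
def codeWord (eL : Letter Γ → ℕ) (w : TimedWord Γ) : List (ℝ≥0 × ℕ) :=
  w.map fun e => (e.1, eL e.2 + 1)

omit [Inhabited Γ] in
theorem codeWord_injective {eL : Letter Γ → ℕ} (h : Function.Injective eL) :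
    Function.Injective (codeWord eL) := by
  refine List.map_injective_iff.2 fun e e' he => ?_
  simp only [Prod.mk.injEq, add_left_inj] at he
  exact Prod.ext he.1 (h he.2)

variable {M : TM0.Machine Γ Λ} {a b c : Γ} {n : ℕ} {eX : Loc Γ Λ → ℕ}
  {eL : Letter Γ → ℕ} {A : TimedAutomaton}

theorem Realizes.step_act_iff (hA : Realizes M a b c n eX eL A) {x : Loc Γ Λ} {v : Val}
    {o : Option ℕ} {s : AState} :
    A.Step (eX x, v) (.act o) s ↔ ∃ g l R y, Trans M a b c n x g l R y ∧ l.code eL = o ∧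
      (∀ t ∈ g, t.holds v) ∧ s = (eX y, v.reset R) := by
  have hinv : ∀ q v, A.InvHolds q v := fun q v g hg => by rw [hA.inv] at hg; simp at hg
  constructor
  · rintro ⟨e, he, h1, h2, h3, h4, h5, -⟩
    obtain ⟨x', g, l, R, y, ht, rfl⟩ := (hA.mem_edges e).1 he
    cases hA.injLoc h1
    exact ⟨g, l, R, y, ht, h2, h4, Prod.ext h3.symm h5⟩
  · rintro ⟨g, l, R, y, ht, h2, h4, rfl⟩
    exact ⟨_, (hA.mem_edges _).2 ⟨x, g, l, R, y, ht, rfl⟩, rfl, h2, rfl, h4, rfl, hinv _ _⟩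

theorem Realizes.step_delay_iff (hA : Realizes M a b c n eX eL A) {q : ℕ} {v : Val}
    {d : ℝ≥0} {s : AState} :
    A.Step (q, v) (.delay d) s ↔ s = (q, v.delay d) := by
  have hinv : ∀ q v, A.InvHolds q v := fun q v g hg => by rw [hA.inv] at hg; simp at hg
  constructor
  · rintro ⟨h1, h2, -⟩
    exact Prod.ext h1 h2
  · rintro rfl
    exact ⟨rfl, rfl, fun _ _ _ => hinv _ _⟩

theorem Trans.tgt_ne_init {x y : Loc Γ Λ} {g : List Atom} {l : Lab Γ} {R : List ℕ}
    (h : Trans M a b c n x g l R y) : y ≠ .init := by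
  cases h <;> simp

theorem Trans.exists_low {x y : Loc Γ Λ} {g : List Atom} {l : Lab Γ} {R : List ℕ}
    (h : Trans M a b c n x g l R y) (hx : x ≠ .init) : ∃ l', l = .low l' := by
  cases h <;> simp at hx ⊢

theorem Val.delay_delay (v : Val) (d d' : ℝ≥0) : (v.delay d).delay d' = v.delay (d + d') := by
  funext x
  simp [Val.delay, add_assoc]

theorem Val.delay_zero (v : Val) : v.delay 0 = v := by
  funext x
  simp [Val.delay]

@[simp] theorem Val.reset_nil (v : Val) : v.reset [] = v := by
  funext x
  simp [Val.reset]

/-- Away from the initial location there are only low-level steps, so that a run which starts there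
reads a timed word. The time `d` has passed since the last letter. -/
theorem Realizes.exists_reads (hA : Realizes M a b c n eX eL A)
    {T : AState → Label → AState → Prop}
    (hT : ∀ x v l s, x ≠ .init → (T (eX x, v) l s ↔ A.Step (eX x, v) l s))
    {x : Loc Γ Λ} (hx : x ≠ .init) {v : Val} {d : ℝ≥0} {ls : List Label} {t : AState}
    (h : Path T (eX x, v.delay d) ls t) :
    ∃ w, Reads M a b c n x v w ∧ traceFrom d ls = codeWord eL w := by
  induction ls generalizing x v d with
  | nil => exact ⟨[], trivial, rfl⟩
  | cons l ls ih =>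
    obtain ⟨s, hs, h⟩ := h
    rw [hT _ _ _ _ hx] at hs
    rcases l with o | d'
    · obtain ⟨g, l, R, y, ht, ho, hg, rfl⟩ := hA.step_act_iff.1 hs
      obtain ⟨l, rfl⟩ := ht.exists_low hx
      obtain rfl := ho
      obtain ⟨w, hw, hl⟩ := ih ht.tgt_ne_init (v := (v.delay d).reset R) (d := 0)
        (by rwa [Val.delay_zero])
      refine ⟨(d, l) :: w, ⟨g, R, y, ht, hg, hw⟩, ?_⟩
      simp [Lab.code, traceFrom, hl, codeWord]
    · obtain rfl := hA.step_delay_iff.1 hs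
      rw [Val.delay_delay] at h
      exact ih hx h

theorem Realizes.exists_path (hA : Realizes M a b c n eX eL A)
    {T : AState → Label → AState → Prop}
    (hT : ∀ x v l s, x ≠ .init → (T (eX x, v) l s ↔ A.Step (eX x, v) l s))
    {x : Loc Γ Λ} (hx : x ≠ .init) {v : Val} {w : TimedWord Γ} (h : Reads M a b c n x v w) :
    ∃ ls t, Path T (eX x, v) ls t ∧ traceFrom 0 ls = codeWord eL w := by
  induction w generalizing x v with
  | nil => exact ⟨[], _, rfl, rfl⟩
  | cons e w ih =>
    obtain ⟨d, l⟩ := e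
    obtain ⟨g, R, y, ht, hg, hw⟩ := h
    obtain ⟨ls, t, h1, h2⟩ := ih ht.tgt_ne_init hw
    refine ⟨.delay d :: .act (some (eL l + 1)) :: ls, t,
      ⟨_, (hT _ _ _ _ hx).2 (hA.step_delay_iff.2 rfl), _,
        (hT _ _ _ _ hx).2 (hA.step_act_iff.2 ⟨g, .low l, R, y, ht, rfl, hg, rfl⟩), h1⟩, ?_⟩
    simp [traceFrom, h2, codeWord]

/-- Hiding the high-level action changes nothing away from the initial location. -/
theorem Realizes.hide_iff (hA : Realizes M a b c n eX eL A) (x : Loc Γ Λ) (v : Val)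
    (l : Label) (s : AState) (hx : x ≠ .init) :
    (A.semantics.hide [0]).trans (eX x, v) l s ↔ A.Step (eX x, v) l s := by
  have key : ∀ l', A.Step (eX x, v) l' s → hideLabel [0] l' = l' := by
    rintro (_ | k) h
    · obtain ⟨g, l, R, y, ht, ho, -, -⟩ := hA.step_act_iff.1 h
      obtain ⟨l, rfl⟩ := ht.exists_low hx
      obtain rfl := ho
      simp [Lab.code, hideLabel]
    · rfl
  constructor
  · rintro ⟨l', h, rfl⟩
    rwa [key l' h]
  · exact fun h => ⟨l, h, key l h⟩

theorem Realizes.restrict_iff (hA : Realizes M a b c n eX eL A) (x : Loc Γ Λ) (v : Val)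
    (l : Label) (s : AState) (hx : x ≠ .init) :
    (A.semantics.restrict [0]).trans (eX x, v) l s ↔ A.Step (eX x, v) l s := by
  refine ⟨fun h => h.1, fun h => ⟨h, fun k hk => ?_⟩⟩
  rintro rfl
  obtain ⟨g, l, R, y, ht, ho, -, -⟩ := hA.step_act_iff.1 h
  obtain ⟨l, rfl⟩ := ht.exists_low hx
  simp only [List.mem_singleton] at hk
  subst hk
  simp [Lab.code] at ho

/-- If the locations in `Y` can be entered silently from the initial location, and nothing else can
happen there except that time passes, then the traces are the words that are read from `Y`. -/
theorem Realizes.traces_init (hA : Realizes M a b c n eX eL A)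
    {T : AState → Label → AState → Prop}
    (hT : ∀ x v l s, x ≠ .init → (T (eX x, v) l s ↔ A.Step (eX x, v) l s)) {Y : Set (Loc Γ Λ)}
    (hY : Y.Nonempty) (hY' : .init ∉ Y)
    (hinit : ∀ v l s, T (eX .init, v) l s ↔ (∃ d, l = .delay d ∧ s = (eX .init, v.delay d)) ∨
      l = .act none ∧ ∃ y ∈ Y, s = (eX y, v)) (v : Val) :
    {w | ∃ ls t, Path T (eX .init, v) ls t ∧ traceFrom 0 ls = w} =
      codeWord eL '' {w | ∃ y ∈ Y, Reads M a b c n y v w} := by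
  ext w
  constructor
  · rintro ⟨ls, t, h, rfl⟩
    rw [← v.delay_zero] at h
    generalize (0 : ℝ≥0) = d at h ⊢
    induction ls generalizing d with
    | nil =>
      obtain ⟨y, hy⟩ := hY
      exact ⟨[], ⟨y, hy, trivial⟩, rfl⟩
    | cons l ls ih =>
      obtain ⟨s, hs, h⟩ := h
      rcases (hinit _ _ _).1 hs with ⟨d', rfl, rfl⟩ | ⟨rfl, y, hy, rfl⟩
      · rw [Val.delay_delay] at h
        exact ih _ h
      · obtain ⟨w, h1, h2⟩ := hA.exists_reads hT (by rintro rfl; exact hY' hy) h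
        exact ⟨w, ⟨y, hy, h1⟩, h2.symm⟩
  · rintro ⟨w, ⟨y, hy, h⟩, rfl⟩
    obtain ⟨ls, t, h1, h2⟩ := hA.exists_path hT (by rintro rfl; exact hY' hy) h
    exact ⟨.act none :: ls, t, ⟨_, (hinit _ _ _).2 (.inr ⟨rfl, y, hy, rfl⟩), h1⟩, h2⟩

theorem Realizes.language_restrict (hA : Realizes M a b c n eX eL A) :
    (A.semantics.restrict [0]).language =
      codeWord eL '' {w | Reads M a b c n .watch (fun _ => 0) w} := by
  have h := hA.traces_init (T := (A.semantics.restrict [0]).trans) (Y := {.watch})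
    hA.restrict_iff ⟨_, rfl⟩ (by simp) (fun v l s => ?_) (fun _ => 0)
  · simp only [Set.mem_singleton_iff, exists_eq_left, ← hA.start] at h
    rw [← h]
    simp only [TTS.language, TTS.reaches_iff_path]
    rfl
  · constructor
    · rintro ⟨h, hne⟩
      rcases l with o | d
      · obtain ⟨g, l, R, y, ht, rfl, -, rfl⟩ := hA.step_act_iff.1 h
        cases ht with
        | enter => exact .inr ⟨rfl, _, rfl, by simp⟩
        | high => exact absurd rfl (hne 0 (by simp))
      · exact .inl ⟨d, rfl, hA.step_delay_iff.1 h⟩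
    · rintro (⟨d, rfl, rfl⟩ | ⟨rfl, y, rfl, rfl⟩)
      · exact ⟨hA.step_delay_iff.2 rfl, by simp⟩
      · exact ⟨hA.step_act_iff.2 ⟨_, _, _, _, .enter, rfl, by simp, by simp⟩,
          by simp⟩

theorem Realizes.language_hide (hA : Realizes M a b c n eX eL A) :
    (A.semantics.hide [0]).language =
      codeWord eL '' {w | Reads M a b c n .watch (fun _ => 0) w ∨
        Reads M a b c n (.gen .start) (fun _ => 0) w} := by
  have h := hA.traces_init (T := (A.semantics.hide [0]).trans) (Y := {.watch, .gen .start})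
    hA.hide_iff ⟨_, .inl rfl⟩ (by simp) (fun v l s => ?_) (fun _ => 0)
  · simp only [Set.mem_insert_iff, Set.mem_singleton_iff, exists_eq_or_imp, exists_eq_left,
      ← hA.start] at h
    rw [← h]
    simp only [TTS.language, TTS.reaches_iff_path]
    rfl
  · constructor
    · rintro ⟨l', h, rfl⟩
      rcases l' with o | d
      · obtain ⟨g, l, R, y, ht, rfl, -, rfl⟩ := hA.step_act_iff.1 h
        cases ht with
        | enter => exact .inr ⟨rfl, _, .inl rfl, by simp⟩
        | high => exact .inr ⟨by simp [Lab.code, hideLabel], _, .inr rfl, by simp⟩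
      · exact .inl ⟨d, rfl, hA.step_delay_iff.1 h⟩
    · rintro (⟨d, rfl, rfl⟩ | ⟨rfl, y, rfl | rfl, rfl⟩)
      · exact ⟨.delay d, hA.step_delay_iff.2 rfl, rfl⟩
      · exact ⟨.act none, hA.step_act_iff.2 ⟨_, _, _, _, .enter, rfl, by simp, by simp⟩, rfl⟩
      · exact ⟨.act (some 0), hA.step_act_iff.2 ⟨_, _, _, _, .high, rfl, by simp, by simp⟩,
          by simp [hideLabel]⟩

/-- The control problem for the timed automaton is the complement of the halting problem. -/
theorem Realizes.snniControl_iff (hA : Realizes M a b c n eX eL A) :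
    SNNIControl ⟨A, [0], []⟩ ↔
      ¬ (StateTransition.eval (TM0.step M) (TM0.init (a :: b :: List.replicate n c))).Dom := by
  rw [snniControl_iff_of_ctrl_nil, ← reads_gen_subset_iff, TTS.IsSNNI, hA.language_restrict,
    hA.language_hide, (codeWord_injective hA.injLetter).image_injective.eq_iff]
  constructor
  · intro h w hw
    have : w ∈ {w | Reads M a b c n .watch (fun _ => 0) w ∨
        Reads M a b c n (.gen .start) (fun _ => 0) w} := .inr hw
    rwa [← h] at this
  · intro h
    ext w
    exact ⟨.inl, fun hw => hw.elim id (h w)⟩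

end Semantics

/-! ### The reduction is computable -/

section Reduction

variable {Γ Λ : Type}

instance [Finite Γ] : Finite (Letter Γ) :=
  Finite.of_injective
    (fun l : Letter Γ => match l with
      | .tick => none
      | .hash => some none
      | .cell c => some (some c)) fun l l' h => by
        cases l <;> cases l' <;> simp_all

instance [Countable Γ] [Countable Λ] : Countable (Node Γ Λ) :=
  Function.Injective.countable (β := ℕ × Option Λ × Option Γ)
    (f := fun s => match s with
      | .start => (0, none, none)
      | .pad => (1, none, none)
      | .second => (2, none, none)
      | .input k => (k + 9, none, none)
      | .scan q => (3, some q, none)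
      | .leave q x => (4, some q, some x)
      | .arrive q => (5, some q, none)
      | .done q => (6, some q, none)
      | .halted => (7, none, none)
      | .final => (8, none, none)) fun s t h => by
        cases s <;> cases t <;> simp at h ⊢ <;> exact h

instance [Countable Γ] [Countable Λ] [Finite (Letter Γ)] : Countable (Loc Γ Λ) :=
  Function.Injective.countable (β := ℕ × Option (Node Γ Λ) × Option (Letter Γ))
    (f := fun x => match x with
      | .init => (0, none, none)
      | .gen s => (1, some s, none)
      | .watch => (2, none, none)
      | .late l => (3, none, some l)
      | .gap => (4, none, none)
      | .between => (5, none, none)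
      | .ok => (6, none, none)) fun x y h => by
        cases x <;> cases y <;> simp_all

/-- A numbering of the locations that is explicit on those locations which depend on the input. -/
def Loc.code (e : Loc Γ Λ → ℕ) : Loc Γ Λ → ℕ
  | .gen (.input k) => 2 * k + 1
  | x => 2 * e x

theorem Loc.code_injective {e : Loc Γ Λ → ℕ} (he : Function.Injective e) :
    Function.Injective (Loc.code e) := by
  intro x y h
  unfold Loc.code at h
  split at h <;> split at h
  · have : _ = _ := mul_left_cancel₀ two_ne_zero (Nat.succ.inj h)
    rw [this]
  · omega
  · omega
  · exact he (mul_left_cancel₀ two_ne_zero h)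

/-- The edge that reads the cell `d` in the location `x` when `k` letters of the input are still
missing afterwards. -/
def inputEdge (eX : Loc Γ Λ → ℕ) (eL : Letter Γ → ℕ) (d : Content Γ × Content Γ)
    (x : Loc Γ Λ) (k : ℕ) : Edge :=
  ⟨eX x, [⟨0, .lt, 1⟩, ⟨1, .gt, 0⟩], (Lab.low (.cell d)).code eL, [1], eX (.gen (.input k))⟩

variable [Inhabited Γ] [Inhabited Λ]

/-- Apart from the edges that spell out the input, the edges do not depend on the input length. -/
theorem trans_iff {M : TM0.Machine Γ Λ} {a b c : Γ} {n : ℕ} {x y : Loc Γ Λ} {g : List Atom}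
    {l : Lab Γ} {R : List ℕ} :
    Trans M a b c n x g l R y ↔ (Trans M a b c 0 x g l R y ∧ x ≠ .gen .second) ∨
      (g = [⟨0, .lt, 1⟩, ⟨1, .gt, 0⟩] ∧ R = [1] ∧
        ((x = .gen .second ∧ l = .low (.cell ((default, false), (b, false))) ∧
            y = .gen (.input n)) ∨
          ∃ k < n, x = .gen (.input (k + 1)) ∧
            l = .low (.cell ((default, false), (c, false))) ∧ y = .gen (.input k))) := by
  constructor
  · intro h
    cases h with
    | genMark ha hl =>
      cases ha
      all_goals first
        | exact absurd hl id
        | exact .inl ⟨.genMark (by constructor) hl, by simp⟩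
    | genCell ha =>
      cases ha with
      | second => exact .inr ⟨rfl, rfl, .inl ⟨rfl, rfl, rfl⟩⟩
      | input hk => exact .inr ⟨rfl, rfl, .inr ⟨_, hk, rfl, rfl, rfl⟩⟩
      | _ => exact .inl ⟨.genCell (by constructor <;> assumption), by simp⟩
    | _ => exact .inl ⟨by constructor <;> assumption, by simp⟩
  · rintro (⟨h, hx⟩ | ⟨rfl, rfl, ⟨rfl, rfl, rfl⟩ | ⟨k, hk, rfl, rfl, rfl⟩⟩)
    · cases h with
      | genMark ha hl =>
        refine .genMark ?_ hl
        cases ha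
        all_goals first
          | exact absurd hl id
          | constructor
      | genCell ha =>
        refine .genCell ?_
        cases ha with
        | second => exact absurd rfl hx
        | input hk => exact absurd hk (by omega)
        | _ => constructor <;> assumption
      | _ => constructor <;> assumption
    · exact .genCell .second
    · exact .genCell (.input hk)

/-- The locations that occur in the automaton for the input length `0`. -/
def baseLocs (Γ Λ : Type) : Set (Loc Γ Λ) :=
  {x | ∀ k, x ≠ .gen (.input (k + 1))}

theorem finite_baseLocs [Finite Γ] [Finite Λ] : (baseLocs Γ Λ).Finite := by
  have h : baseLocs Γ Λ ⊆
      ({.init, .watch, .gap, .between, .ok, .gen .start, .gen .pad, .gen .second,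
        .gen (.input 0), .gen .halted, .gen .final} : Set (Loc Γ Λ)) ∪
      (Set.range Loc.late ∪ (Set.range fun q => .gen (.scan q)) ∪
        (Set.range fun q => .gen (.arrive q)) ∪ (Set.range fun q => .gen (.done q)) ∪
        (Set.range fun q : Λ × Γ => .gen (.leave q.1 q.2))) := by
    intro x hx
    rcases x with _ | s | _ | l | _ | _ | _
    · simp
    · rcases s with _ | _ | _ | (_ | k) | q | ⟨q, x⟩ | q | q | _ | _
      all_goals first
        | exact absurd rfl (hx _)
        | simp
    all_goals simp
  refine Set.Finite.subset ?_ h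
  refine (Set.toFinite _).union (((((Set.finite_range _).union (Set.finite_range _)).union
    (Set.finite_range _)).union (Set.finite_range _)).union (Set.finite_range _))

theorem finite_baseEdges [Finite Γ] [Finite Λ] (M : TM0.Machine Γ Λ) (a b c : Γ)
    (eX : Loc Γ Λ → ℕ) (eL : Letter Γ → ℕ) :
    {e : Edge | ∃ x g l R y, (Trans M a b c 0 x g l R y ∧ x ≠ .gen .second) ∧
      e = ⟨eX x, g, l.code eL, R, eX y⟩}.Finite := by
  have hfin : (baseLocs Γ Λ).Finite := finite_baseLocs
  let G : Set (List Atom) := {[], [⟨0, .eq, 1⟩], [⟨0, .lt, 1⟩, ⟨1, .gt, 0⟩], [⟨0, .lt, 1⟩],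
    [⟨0, .gt, 1⟩], [⟨0, .gt, 1⟩, ⟨1, .lt, 1⟩]}
  let O : Set (Option ℕ) := {none, some 0} ∪ Set.range fun l : Letter Γ => some (eL l + 1)
  let Rs : Set (List ℕ) := {[], [0], [1], [0, 1]}
  have hG : G.Finite := Set.toFinite _
  have hO : O.Finite := (Set.toFinite _).union (Set.finite_range _)
  have hR : Rs.Finite := Set.toFinite _
  refine (((((hfin.prod hG).prod hO).prod hR).prod hfin).image fun t =>
    (⟨eX t.1.1.1.1, t.1.1.1.2, t.1.1.2, t.1.2, eX t.2⟩ : Edge)).subset ?_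
  rintro e ⟨x, g, l, R, y, ⟨h, -⟩, rfl⟩
  refine ⟨((((x, g), l.code eL), R), y), ⟨⟨⟨⟨?_, ?_⟩, ?_⟩, ?_⟩, ?_⟩, rfl⟩
  · cases h with
    | genMark ha => cases ha <;> first | omega | simp [baseLocs]
    | genCell ha => cases ha <;> first | omega | simp [baseLocs]
    | _ => simp [baseLocs]
  · cases h <;> simp [G]
  · cases l <;> simp [O, Lab.code]
  · cases h <;> simp [Rs]
  · cases h with
    | genMark ha => cases ha <;> first | omega | simp [baseLocs]
    | genCell ha => cases ha <;> first | omega | simp [baseLocs]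
    | _ => simp [baseLocs]

omit [Inhabited Γ] [Inhabited Λ] in
theorem primrec_inputEdge {eX : Loc Γ Λ → ℕ} {eL : Letter Γ → ℕ} {d : Content Γ × Content Γ}
    {x : ℕ → Loc Γ Λ} (hx : Primrec fun k => eX (x k))
    (hin : Primrec fun k => eX (.gen (.input k))) :
    Primrec fun k => inputEdge eX eL d (x k) k :=
  (Primrec.of_equiv_iff Edge.equiv).1 <|
    hx.pair <| (Primrec.const _).pair <| (Primrec.const _).pair <| (Primrec.const _).pair hin

/-- The timed automaton for the input `a b cⁿ` can be computed from `n`. -/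
theorem exists_primrec_realizes [Finite Γ] [Finite Λ] (M : TM0.Machine Γ Λ) (a b c : Γ) :
    ∃ (eX : Loc Γ Λ → ℕ) (eL : Letter Γ → ℕ) (A : ℕ → TimedAutomaton),
      Primrec A ∧ ∀ n, Realizes M a b c n eX eL (A n) := by
  obtain ⟨e, he⟩ := exists_injective_nat (Loc Γ Λ)
  obtain ⟨eL, heL⟩ := exists_injective_nat (Letter Γ)
  let eX := Loc.code e
  have hfin := finite_baseEdges M a b c eX eL
  let E₀ : List Edge := hfin.toFinset.toList
  let d : Γ → Content Γ × Content Γ := fun x => ((default, false), (x, false))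
  let A : ℕ → TimedAutomaton := fun n =>
    ⟨eX .init, E₀ ++ inputEdge eX eL (d b) (.gen .second) n ::
      (List.range n).map fun k => inputEdge eX eL (d c) (.gen (.input (k + 1))) k, []⟩
  have hin : Primrec fun k => eX (.gen (.input k)) :=
    Primrec.nat_add.comp (Primrec.nat_mul.comp (Primrec.const 2) Primrec.id) (Primrec.const 1)
  refine ⟨eX, eL, A, ?_, fun n => ⟨Loc.code_injective he, heL, rfl, rfl, ?_⟩⟩
  · refine (Primrec.of_equiv_iff TimedAutomaton.equiv).1 <|
      (Primrec.const _).pair <| Primrec.pair ?_ (Primrec.const _)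
    refine Primrec.list_append.comp (Primrec.const _) (Primrec.list_cons.comp
      (primrec_inputEdge (Primrec.const _) hin) (Primrec.list_map Primrec.list_range
        ((primrec_inputEdge (hin.comp Primrec.succ) hin).comp Primrec.snd).to₂))
  · intro e'
    simp only [A, List.mem_append, List.mem_cons, List.mem_map, List.mem_range, E₀,
      Finset.mem_toList, Set.Finite.mem_toFinset, Set.mem_ofPred_eq]
    constructor
    · rintro (⟨x, g, l, R, y, h, rfl⟩ | rfl | ⟨k, hk, rfl⟩)
      · exact ⟨x, g, l, R, y, trans_iff.2 (.inl h), rfl⟩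
      · exact ⟨_, _, _, _, _, .genCell .second, rfl⟩
      · exact ⟨_, _, _, _, _, .genCell (.input hk), rfl⟩
    · rintro ⟨x, g, l, R, y, h, rfl⟩
      rcases trans_iff.1 h with h | ⟨rfl, rfl, ⟨rfl, rfl, rfl⟩ | ⟨k, hk, rfl, rfl, rfl⟩⟩
      · exact .inl ⟨x, g, l, R, y, h, rfl⟩
      · exact .inr (.inl rfl)
      · exact .inr (.inr ⟨k, hk, rfl⟩)

end Reduction

/-! ### Undecidability -/

theorem not_computablePred_snniControl : ¬ ComputablePred SNNIControl := by
  rintro ⟨_, hdec⟩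
  obtain ⟨Γ, Λ, _, _, _, _, M, a, b, c, hM⟩ := exists_undecidable_machine
  obtain ⟨eX, eL, A, hA, hreal⟩ := exists_primrec_realizes M a b c
  have hI : Computable fun n => (⟨A n, [0], []⟩ : Input) :=
    ((Primrec.of_equiv_iff Input.equiv).1 <| hA.pair (Primrec.const ([0], []))).to_comp
  have h : ComputablePred fun n => SNNIControl ⟨A n, [0], []⟩ :=
    ⟨fun _ => inferInstance, hdec.comp hI⟩
  exact hM (h.not.of_eq fun n => by rw [(hreal n).snniControl_iff, not_not])

end TimedSNNI

theorem mainTheorem4 :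
    ¬ ComputablePred TimedSNNI.SNNIControl ∧
    ∀ (K : Type) [Primcodable K]
      (decode : TimedSNNI.Input → K → TimedSNNI.Controller),
      ¬ ∃ f : TimedSNNI.Input → Option K,
          Computable f ∧ TimedSNNI.SolvesSNNISynthesis decode f := by
  refine ⟨TimedSNNI.not_computablePred_snniControl, fun K _ decode => ?_⟩
  rintro ⟨f, hf, hsolves⟩
  refine TimedSNNI.not_computablePred_snniControl ?_
  have hiff : ∀ I, (f I).isSome = true ↔ TimedSNNI.SNNIControl I := by
    intro I
    constructor
    · intro h
      by_contra hI
      simp [(hsolves I).2 hI] at h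
    · intro hI
      obtain ⟨k, hk, -⟩ := (hsolves I).1 hI
      simp [hk]
  refine ComputablePred.of_eq (p := fun I => (f I).isSome = true) ⟨fun _ => inferInstance, ?_⟩ hiff
  simpa using Primrec.option_isSome.to_comp.comp hf
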